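/- All simplicial complexes are finite and abstract. A complex $\Delta$ on a finite set $V$ is a family of subsets of $V$ closed under taking subsets and containing $\emptyset$; $|\Delta|$ is its geometric realization, $\Delta[S]=\{F\in\Delta: F\subseteq S\}$ is the subcomplex induced on $S\subseteq V$, and $\mathrm{lk}_\Delta(F)=\{G\in\Delta: F\cap G=\emptyset,\ F\cup G\in\Delta\}$ is the link of a face $F$. The complex $\Delta$ is \emph{flag} if every inclusion-minimal subset of $V$ that is not a face has exactly two elements, and it is a \emph{simplicial $d$-sphere} if $|\Delta|$ is homeomorphic to $\mathbb S^d$ (with $\mathbb S^{-1}=\emptyset$). The join of complexes $\Delta$, $\Gamma$ on disjoint vertex sets is $\Delta*\Gamma=\{F\cup G: F\in\Delta, G\in\Gamma\}$; $\Delta$ is a \emph{suspension} if it is isomorphic to the join of some complex with the complex consisting of two isolated vertices. An edge of $\Delta$ is \emph{contractible} if it is contained in no induced subcomplex of $\Delta$ isomorphic to a $4$-cycle. An \emph{induced equator} of a simplicial $d$-sphere $\Delta$ is an induced subcomplex $E$ of $\Delta$ that is a simplicial $(d-1)$-sphere and in which, moreover, the link of every face is a sphere, that is, $|\mathrm{lk}_E(F)|\cong\mathbb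 S^{d-1-|F|}$ for every $F\in E$. Proposition. Let $m,n\ge 0$, let $\Phi_1$ be a flag simplicial $m$-sphere and $\Phi_2$ a flag simplicial $n$-sphere (on disjoint vertex sets) such that (i) $\Phi_1$ and $\Phi_2$ have no contractible edge and are not suspensions; (ii) every induced equator of $\Phi_1$ is the link of a vertex of $\Phi_1$, and every induced equator of $\Phi_2$ is the link of a vertex of $\Phi_2$. Then $\Phi_1*\Phi_2$ is a flag simplicial $(n+m+1)$-sphere, it has no contractible edge, it is not a suspension, and every induced equator of $\Phi_1*\Phi_2$ is the link of a vertex of $\Phi_1*\Phi_2$. -/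

import Mathlib

/-!
Finite abstract simplicial complexes are Mathlib's `PreAbstractSimplicialComplex V` over a finite
type `V`. In that convention faces are nonempty, so the empty face is left implicit: every complex
is understood to contain it, and `⊥` is the complex whose only face is the empty set.
-/

universe u v

namespace PreAbstractSimplicialComplex

variable {V : Type u} {W : Type v}

/-- The vertices of `K`: the points whose singleton is a face. -/
def vertices (K : PreAbstractSimplicialComplex V) : Set V :=
  {x | {x} ∈ K.faces}

/-- The induced subcomplex `K[S]`: all faces of `K` contained in `S`. -/
def induce (K : PreAbstractSimplicialComplex V) (S : Set V) : PreAbstractSimplicialComplex V where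
  faces := {F | F ∈ K.faces ∧ (F : Set V) ⊆ S}
  isRelLowerSet_faces := by
    rintro F ⟨hF, hS⟩
    refine ⟨(K.isRelLowerSet_faces hF).1, fun G hG hne => ⟨(K.isRelLowerSet_faces hF).2 hG hne, ?_⟩⟩
    exact fun x hx => hS (hG hx)

/-- The link of `F` in `K`: all faces `G` of `K` disjoint from `F` with `F ∪ G` a face of `K`. -/
def link (K : PreAbstractSimplicialComplex V) (F : Finset V) : PreAbstractSimplicialComplex V where
  faces := {G | G ∈ K.faces ∧ ∃ h : Disjoint F G, F.disjUnion G h ∈ K.faces}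
  isRelLowerSet_faces := by
    rintro G ⟨hG, hd, hFG⟩
    refine ⟨(K.isRelLowerSet_faces hG).1, fun H hH hne =>
      ⟨(K.isRelLowerSet_faces hG).2 hH hne, Disjoint.mono_right hH hd, ?_⟩⟩
    refine (K.isRelLowerSet_faces hFG).2 ?_ ?_
    · intro x hx
      rw [Finset.mem_disjUnion] at hx ⊢
      exact hx.imp id (fun h => hH h)
    · obtain ⟨x, hx⟩ := hne
      exact ⟨x, Finset.mem_disjUnion.2 (Or.inr hx)⟩

/-- The simplicial join of two complexes, on the disjoint union of the vertex sets: its faces are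
the nonempty unions of a (possibly empty) face of `K` and a (possibly empty) face of `L`. -/
def join (K : PreAbstractSimplicialComplex V) (L : PreAbstractSimplicialComplex W) :
    PreAbstractSimplicialComplex (V ⊕ W) where
  faces := {F | F.Nonempty ∧ (F.toLeft = ∅ ∨ F.toLeft ∈ K.faces) ∧
    (F.toRight = ∅ ∨ F.toRight ∈ L.faces)}
  isRelLowerSet_faces := by
    rintro F ⟨hF, hK, hL⟩
    refine ⟨hF, fun G hG hne => ⟨hne, ?_, ?_⟩⟩
    · have hsub : G.toLeft ⊆ F.toLeft := Finset.toLeft_subset_toLeft hG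
      rcases G.toLeft.eq_empty_or_nonempty with h | h
      · exact Or.inl h
      · rcases hK with hK | hK
        · rw [hK] at hsub
          exact Or.inl (Finset.subset_empty.1 hsub)
        · exact Or.inr ((K.isRelLowerSet_faces hK).2 hsub h)
    · have hsub : G.toRight ⊆ F.toRight := Finset.toRight_subset_toRight hG
      rcases G.toRight.eq_empty_or_nonempty with h | h
      · exact Or.inl h
      · rcases hL with hL | hL
        · rw [hL] at hsub
          exact Or.inl (Finset.subset_empty.1 hsub)
        · exact Or.inr ((L.isRelLowerSet_faces hL).2 hsub h)

/-- Isomorphism of complexes: a bijection of the vertices that identifies the faces. -/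
def Isomorphic (K : PreAbstractSimplicialComplex V) (L : PreAbstractSimplicialComplex W) : Prop :=
  ∃ e : K.vertices ≃ L.vertices, ∀ F : Finset K.vertices,
    F.map (Function.Embedding.subtype _) ∈ K.faces ↔
      (F.map e.toEmbedding).map (Function.Embedding.subtype _) ∈ L.faces

/-- The complex consisting of two isolated vertices. -/
def twoPoints : PreAbstractSimplicialComplex (Fin 2) where
  faces := {F | F.card = 1}
  isRelLowerSet_faces := by
    intro F hF
    have hF' : F.card = 1 := hF
    refine ⟨Finset.card_pos.1 (by omega), fun G hG hne => ?_⟩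
    have h1 := Finset.card_le_card hG
    have h2 := Finset.card_pos.2 hne
    change G.card = 1
    omega

/-- The `4`-cycle: vertices `0, 1, 2, 3` and edges `01`, `12`, `23`, `30`. -/
def fourCycle : PreAbstractSimplicialComplex (Fin 4) where
  faces := {F | F.Nonempty ∧ ∃ i : Fin 4, F ⊆ {i, i + 1}}
  isRelLowerSet_faces := by
    rintro F ⟨hF, i, hi⟩
    exact ⟨hF, fun G hG hne => ⟨hne, i, fun x hx => hi (hG hx)⟩⟩

/-- `K` is a suspension: it is isomorphic to the join of some complex with two points. -/
def IsSuspension (K : PreAbstractSimplicialComplex V) : Prop :=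
  ∃ (U : Type u) (L : PreAbstractSimplicialComplex U), K.Isomorphic (L.join twoPoints)

/-- `K` is flag (as a complex on `V`): every minimal non-face has cardinality `2`. In particular
every element of `V` is a vertex of `K`. -/
def IsFlag (K : PreAbstractSimplicialComplex V) : Prop :=
  ∀ F : Finset V, F.Nonempty → F ∉ K.faces →
    (∀ G : Finset V, G ⊂ F → G.Nonempty → G ∈ K.faces) → F.card = 2

/-- `F` is a contractible edge of `K`: an edge contained in no induced `4`-cycle of `K`. -/
def IsContractibleEdge (K : PreAbstractSimplicialComplex V) (F : Finset V) : Prop :=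
  F ∈ K.faces ∧ F.card = 2 ∧
    ¬ ∃ S : Set V, F ∈ (K.induce S).faces ∧ (K.induce S).Isomorphic fourCycle

/-- `E` is the link of a vertex of `K`. -/
def IsVertexLink (K E : PreAbstractSimplicialComplex V) : Prop :=
  ∃ x ∈ K.vertices, E = K.link {x}

variable [Fintype V]

/-- The geometric realization `|K|`, as a subset of `ℝ^V`: points with barycentric coordinates
supported on a face of `K`. -/
def realization (K : PreAbstractSimplicialComplex V) : Set (V → ℝ) :=
  {p | p ∈ stdSimplex ℝ V ∧ ∃ F ∈ K.faces, ∀ x, x ∉ F → p x = 0}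

/-- `|K|` is homeomorphic to the unit sphere of `ℝ^k`, that is, `K` is a simplicial
`(k - 1)`-sphere. For `k = 0` this means that `K` has no nonempty face. -/
def IsSphereIn (k : ℕ) (K : PreAbstractSimplicialComplex V) : Prop :=
  Nonempty (K.realization ≃ₜ Metric.sphere (0 : EuclideanSpace ℝ (Fin k)) 1)

/-- `K` is a simplicial `d`-sphere: `|K|` is homeomorphic to `𝕊^d`. -/
def IsSimplicialSphere (d : ℕ) (K : PreAbstractSimplicialComplex V) : Prop :=
  K.IsSphereIn (d + 1)

/-- For a simplicial `(k - 1)`-sphere `E`: the link of every (nonempty) face `F` of `E` is a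
simplicial sphere too, of dimension `k - 1 - |F|`. -/
def HasSphericalLinks (k : ℕ) (E : PreAbstractSimplicialComplex V) : Prop :=
  ∀ F ∈ E.faces, ∃ j : ℕ, j + F.card = k ∧ (E.link F).IsSphereIn j

/-- `E` is an induced equator of the simplicial `d`-sphere `K`: an induced subcomplex of `K` that
is a simplicial `(d - 1)`-sphere, with links that are spheres. -/
def IsInducedEquator (d : ℕ) (K E : PreAbstractSimplicialComplex V) : Prop :=
  (∃ S : Set V, E = K.induce S) ∧ E.IsSphereIn d ∧ E.HasSphericalLinks d

end PreAbstractSimplicialComplex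

/-! Flagness, contractible edges and suspensions only involve adjacency. In a join every vertex of
one factor is adjacent to every vertex of the other. A join of cliques is therefore a clique, and an
edge inside one factor keeps its induced 4-cycle. A mixed edge `xy` lies in the induced 4-cycle `x,
y, x', y'`, where `x'`, `y'` are non-neighbours of `x`, `y` in their factors. The two poles of a
suspension are not adjacent, hence lie in one factor, and that factor is then a suspension. The join
of spheres is a sphere because the cone over a sphere is a Euclidean space
(`IsSphereIn.exists_radial`).

For equators, an induced subcomplex of the join is a join `E₁ * E₂` of induced subcomplexes. Links
of faces in a join are joins of links. The link of a facet of `E₂` is thus a copy of `E₁`, so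
sphericity of links passes to both factors without any homology (`factors_of_isSphereIn_join`). A
sphere inside a sphere has at most its dimension, and by this count one `Eᵢ` has the full dimension
of its factor while the other has codimension one. The former is the whole factor and the latter is
a vertex link by hypothesis, so `E₁ * E₂` is the link of that vertex in the join.

The topological input is that an injective continuous map of spheres cannot lower the dimension, and
is onto when the dimensions agree. Both follow from `borsuk_ulam`, which is proved with mod 2
cochains on small tuples of points. -/

/-! ### Mod 2 cochains on ordered tuples -/

section Cochains

variable {X Y : Type*}

/-- The coboundary of a mod `2` cochain on ordered tuples. -/
def coboundary : (List X → ZMod 2) → List X → ZMod 2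
  | _, [] => 0
  | φ, x :: l => φ l + coboundary (fun l' => φ (x :: l')) l

/-- The prism operator between the pullbacks of cochains along `f` and along `g`. -/
def prism (f g : X → Y) : (List Y → ZMod 2) → List X → ZMod 2
  | _, [] => 0
  | φ, x :: l => φ (f x :: g x :: l.map g) + prism f g (fun l' => φ (f x :: l')) l

theorem two_eq_zero_zmod : (2 : ZMod 2) = 0 := rfl

theorem coboundary_add (φ ψ : List X → ZMod 2) (l : List X) :
    coboundary (fun l => φ l + ψ l) l = coboundary φ l + coboundary ψ l := by
  induction l generalizing φ ψ with
  | nil => simp [coboundary]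
  | cons x l ih => simp only [coboundary, ih]; ring

theorem coboundary_const_mul (a : ZMod 2) (φ : List X → ZMod 2) (l : List X) :
    coboundary (fun l => a * φ l) l = a * coboundary φ l := by
  induction l generalizing φ with
  | nil => simp [coboundary]
  | cons x l ih => simp only [coboundary, ih]; ring

theorem coboundary_map (f : X → Y) (φ : List Y → ZMod 2) (l : List X) :
    coboundary (fun l => φ (l.map f)) l = coboundary φ (l.map f) := by
  induction l generalizing φ with
  | nil => simp [coboundary]
  | cons x l ih =>
    simp only [coboundary, List.map_cons]
    rw [ih (fun l' => φ (f x :: l'))]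

theorem coboundary_congr {φ ψ : List X → ZMod 2} {l : List X}
    (h : ∀ l', l' ⊆ l → φ l' = ψ l') : coboundary φ l = coboundary ψ l := by
  induction l generalizing φ ψ with
  | nil => simp [coboundary]
  | cons x l ih =>
    simp only [coboundary]
    rw [h l (List.subset_cons_self x l), ih fun l' hl' => h _ (List.cons_subset_cons x hl')]

theorem coboundary_coboundary (φ : List X → ZMod 2) (l : List X) :
    coboundary (coboundary φ) l = 0 := by
  induction l generalizing φ with
  | nil => simp [coboundary]
  | cons x l ih =>
    simp only [coboundary, coboundary_add, ih]
    linear_combination coboundary φ l * two_eq_zero_zmod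

theorem prism_add (f g : X → Y) (φ ψ : List Y → ZMod 2) (l : List X) :
    prism f g (fun l => φ l + ψ l) l = prism f g φ l + prism f g ψ l := by
  induction l generalizing φ ψ with
  | nil => simp [prism]
  | cons x l ih => simp only [prism, ih]; ring

theorem prism_congr {f g : X → Y} {φ ψ : List Y → ZMod 2} {l : List X}
    (h : ∀ l', (∀ y ∈ l', ∃ x ∈ l, y = f x ∨ y = g x) → φ l' = ψ l') :
    prism f g φ l = prism f g ψ l := by
  induction l generalizing φ ψ with
  | nil => simp [prism]
  | cons x l ih =>
    simp only [prism]
    congr 1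
    · apply h
      intro y hy
      simp only [List.mem_cons, List.mem_map] at hy
      rcases hy with rfl | rfl | ⟨z, hz, rfl⟩
      · exact ⟨x, by simp, Or.inl rfl⟩
      · exact ⟨x, by simp, Or.inr rfl⟩
      · exact ⟨z, by simp [hz], Or.inr rfl⟩
    · refine ih fun l' hl' => h _ fun y hy => ?_
      rcases List.mem_cons.1 hy with rfl | hy
      · exact ⟨x, by simp, Or.inl rfl⟩
      · obtain ⟨z, hz, hz'⟩ := hl' y hy
        exact ⟨z, by simp [hz], hz'⟩

/-- The usual cochain homotopy: when the first vertex is peeled off, all terms except the two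
pullbacks occur twice and cancel mod 2. -/
theorem coboundary_prism (f g : X → Y) (φ : List Y → ZMod 2) (l : List X) :
    coboundary (prism f g φ) l + prism f g (coboundary φ) l =
      φ (l.map f) + φ (l.map g) := by
  induction l generalizing φ with
  | nil =>
    simp only [coboundary, prism, List.map_nil]
    linear_combination -φ [] * two_eq_zero_zmod
  | cons x l ih =>
    have h1 := ih (fun l' => φ (f x :: l'))
    have h2 := coboundary_map g (fun l' => φ (f x :: g x :: l')) l
    simp only [coboundary, prism, List.map_cons, coboundary_add, prism_add] at h1 ⊢
    rw [h2]
    linear_combination h1 + (prism f g φ l + coboundary (fun l' => φ (f x :: g x :: l')) (l.map g) +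
      φ (f x :: l.map g)) * two_eq_zero_zmod

/-- Multiplication of a cochain by a function of the first vertex. -/
def headMul (p : X → ZMod 2) (φ : List X → ZMod 2) : List X → ZMod 2
  | [] => 0
  | x :: l => p x * φ (x :: l)

/-- The cup product of the coboundaries of `p 0, …, p (k - 1)`. -/
def cupCoboundaries (p : ℕ → X → ZMod 2) : ℕ → List X → ZMod 2
  | 0 => fun l => if l.length = 1 then 1 else 0
  | k + 1 => coboundary (headMul (p k) (cupCoboundaries p k))

theorem cupCoboundaries_nil (p : ℕ → X → ZMod 2) (k : ℕ) : cupCoboundaries p k [] = 0 := by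
  cases k <;> simp [cupCoboundaries, coboundary]

theorem coboundary_eq_zero {φ : List X → ZMod 2} {l : List X}
    (h : ∀ l', l' ⊆ l → φ l' = 0) : coboundary φ l = 0 := by
  rw [coboundary_congr (ψ := fun _ => 0 * 0) (by simpa using h), coboundary_const_mul, zero_mul]

theorem coboundary_cupCoboundaries (p : ℕ → X → ZMod 2) (k : ℕ) (l : List X) :
    coboundary (cupCoboundaries p k) l = 0 := by
  cases k with
  | succ k => exact coboundary_coboundary _ l
  | zero =>
    match l with
    | [] => rfl
    | [x] => simp [cupCoboundaries, coboundary]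
    | [x, y] => simp [cupCoboundaries, coboundary]; rfl
    | x :: y :: z :: l =>
      simp only [coboundary, cupCoboundaries, List.length_cons]
      simpa using coboundary_eq_zero fun _ _ => rfl

/-- Where `p i` is constant, the factor with index `i` contributes the coboundary of a multiple of a
cocycle, which is zero. The later factors preserve this vanishing. -/
theorem cupCoboundaries_eq_zero (p : ℕ → X → ZMod 2) {i k : ℕ} (hik : i < k) {S : Set X}
    {a : ZMod 2} (ha : ∀ x ∈ S, p i x = a) {l : List X} (hl : ∀ x ∈ l, x ∈ S) :
    cupCoboundaries p k l = 0 := by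
  induction k, hik using Nat.le_induction generalizing l with
  | base =>
    rw [cupCoboundaries, coboundary_congr (ψ := fun l => a * cupCoboundaries p i l),
      coboundary_const_mul, coboundary_cupCoboundaries, mul_zero]
    rintro (_ | ⟨x, l'⟩) hl'
    · simp [headMul, cupCoboundaries_nil]
    · rw [headMul, ha x (hl x (hl' (by simp)))]
  | succ k hk ih =>
    rw [cupCoboundaries]
    apply coboundary_eq_zero
    rintro (_ | ⟨x, l'⟩) hl'
    · rfl
    · rw [headMul, ih (fun y hy => hl y (hl' hy)), mul_zero]

theorem headMul_map (p : X → ZMod 2) (φ : List X → ZMod 2) {ν : X → X} {l : List X}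
    (h0 : φ [] = 0) (hp : ∀ x ∈ l, p (ν x) = p x + 1) (hφ : φ (l.map ν) = φ l) :
    headMul p φ (l.map ν) = headMul p φ l + φ l := by
  match l with
  | [] => simp [headMul, h0]
  | x :: l =>
    rw [List.map_cons] at hφ ⊢
    rw [headMul, headMul, hp x (by simp), hφ]
    ring

/-- Composition with `ν` adds 1 to `p k`, so it adds the previous product to the cochain under the
coboundary. That product is a cocycle, so the coboundary does not change. -/
theorem cupCoboundaries_map (p : ℕ → X → ZMod 2) {ν : X → X} {S : Set X}
    (hp : ∀ i, ∀ x ∈ S, p i (ν x) = p i x + 1) (k : ℕ) {l : List X} (hl : ∀ x ∈ l, x ∈ S) :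
    cupCoboundaries p k (l.map ν) = cupCoboundaries p k l := by
  induction k generalizing l with
  | zero => simp [cupCoboundaries]
  | succ k ih =>
    rw [cupCoboundaries, ← coboundary_map, coboundary_congr (ψ := fun l =>
      headMul (p k) (cupCoboundaries p k) l + cupCoboundaries p k l), coboundary_add,
      coboundary_cupCoboundaries, add_zero]
    exact fun l' hl' => headMul_map _ _ (cupCoboundaries_nil p k)
      (fun x hx => hp k x (hl x (hl' hx))) (ih fun x hx => hl x (hl' hx))

/-- The chain homotopy of a discrete homotopy `f 0, …, f M`, followed by the cone over `e`. -/
def contraction (f : ℕ → X → X) (M : ℕ) (e : X) (φ : List X → ZMod 2) (l : List X) : ZMod 2 :=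
  ∑ j ∈ Finset.range M, prism (f j) (f (j + 1)) φ l + φ (e :: l.map fun _ => e)

theorem contraction_add (f : ℕ → X → X) (M : ℕ) (e : X) (φ ψ : List X → ZMod 2) (l : List X) :
    contraction f M e (fun l => φ l + ψ l) l = contraction f M e φ l + contraction f M e ψ l := by
  simp only [contraction, prism_add, Finset.sum_add_distrib]
  ring

/-- The prism identities telescope from the identity to the constant map `e`, and the cone term
cancels the pullback along the constant map. -/
theorem coboundary_contraction (f : ℕ → X → X) (M : ℕ) (e : X) (h0 : ∀ x, f 0 x = x)
    (hM : ∀ x, f M x = e) (φ : List X → ZMod 2) (l : List X) :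
    contraction f M e (coboundary φ) l = φ l + coboundary (contraction f M e φ) l := by
  have key : ∀ n, ∑ j ∈ Finset.range n, prism (f j) (f (j + 1)) (coboundary φ) l =
      φ (l.map (f 0)) + φ (l.map (f n)) +
        coboundary (fun l => ∑ j ∈ Finset.range n, prism (f j) (f (j + 1)) φ l) l := by
    intro n
    induction n with
    | zero =>
      have : coboundary (fun _ : List X => (0 : ZMod 2)) l = 0 := coboundary_eq_zero (by simp)
      simp only [Finset.range_zero, Finset.sum_empty, this]
      linear_combination -φ (l.map (f 0)) * two_eq_zero_zmod
    | succ n ih =>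
      have h1 := coboundary_prism (f n) (f (n + 1)) φ l
      simp only [Finset.sum_range_succ, coboundary_add, ih]
      linear_combination h1 + (φ (l.map (f n)) -
        coboundary (prism (f n) (f (n + 1)) φ) l) * two_eq_zero_zmod
  have hid : f 0 = id := funext h0
  have hc : f M = fun _ => e := funext hM
  have h2 := coboundary_map (fun _ => e) (fun l' => φ (e :: l')) l
  have h3 : coboundary (contraction f M e φ) l =
      coboundary (fun l => ∑ j ∈ Finset.range M, prism (f j) (f (j + 1)) φ l) l +
        coboundary (fun l => φ (e :: l.map fun _ => e)) l := by
    rw [← coboundary_add]; rfl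
  rw [contraction, key, h3, h2, coboundary, hid, hc, List.map_id]
  linear_combination φ (l.map fun _ => e) * two_eq_zero_zmod

end Cochains

/-! ### The Borsuk–Ulam theorem -/

section BorsukUlam

open Real

/-- The `k`-dimensional standard subsphere of the unit sphere of `ℝ^N`. -/
def coordSphere (N k : ℕ) : Set (EuclideanSpace ℝ (Fin N)) :=
  {x | ‖x‖ = 1 ∧ ∀ i : Fin N, k < i → x i = 0}

/-- Tuples of points of a set at mutual distance less than `ε`. -/
def IsSmallTuple {X : Type*} [PseudoMetricSpace X] (S : Set X) (ε : ℝ) (l : List X) : Prop :=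
  ∀ x ∈ l, x ∈ S ∧ ∀ y ∈ l, dist x y < ε

theorem neg_mem_coordSphere {N k : ℕ} {x : EuclideanSpace ℝ (Fin N)} (hx : x ∈ coordSphere N k) :
    -x ∈ coordSphere N k :=
  ⟨by rw [norm_neg]; exact hx.1, fun i hi => by simp [hx.2 i hi]⟩

theorem IsSmallTuple.map_neg {N k : ℕ} {ε : ℝ} {l : List (EuclideanSpace ℝ (Fin N))}
    (hl : IsSmallTuple (coordSphere N k) ε l) :
    IsSmallTuple (coordSphere N k) ε (l.map fun x => -x) := by
  intro x' hx'
  obtain ⟨x, hx, rfl⟩ := List.mem_map.1 hx'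
  refine ⟨neg_mem_coordSphere (hl x hx).1, fun y' hy' => ?_⟩
  obtain ⟨y, hy, rfl⟩ := List.mem_map.1 hy'
  simpa using (hl x hx).2 y hy

/-- Rotation of the points orthogonal to `e` towards `e`. -/
noncomputable def rotateTo {N : ℕ} (e : EuclideanSpace ℝ (Fin N)) (θ : ℝ)
    (x : EuclideanSpace ℝ (Fin N)) :
    EuclideanSpace ℝ (Fin N) :=
  cos θ • x + sin θ • e

theorem rotateTo_mem {N k : ℕ} (hk : k + 1 < N) (θ : ℝ) {x : EuclideanSpace ℝ (Fin N)}
    (hx : x ∈ coordSphere N k) :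
    rotateTo (EuclideanSpace.single ⟨k + 1, hk⟩ 1) θ x ∈ coordSphere N (k + 1) := by
  constructor
  · have h0 : inner ℝ (cos θ • x) (sin θ • EuclideanSpace.single (⟨k + 1, hk⟩ : Fin N) (1 : ℝ)) = 0 := by
      rw [inner_smul_left, inner_smul_right, EuclideanSpace.inner_single_right,
        hx.2 ⟨k + 1, hk⟩ (by simp)]
      simp
    have h1 := norm_add_sq_eq_norm_sq_add_norm_sq_real h0
    rw [norm_smul, norm_smul, hx.1, PiLp.norm_single] at h1
    simp only [norm_eq_abs, norm_one, mul_one, abs_mul_abs_self] at h1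
    rw [← sq, ← sq, ← sq, cos_sq_add_sin_sq] at h1
    exact (pow_eq_one_iff_of_nonneg (norm_nonneg _) two_ne_zero).1 h1
  · intro i hi
    have : i ≠ ⟨k + 1, hk⟩ := by rintro rfl; simp at hi
    simp [rotateTo, hx.2 i (by omega), this]

theorem dist_rotateTo_le {N : ℕ} {e x y : EuclideanSpace ℝ (Fin N)} (he : ‖e‖ = 1) (hy : ‖y‖ = 1)
    (θ η : ℝ) : dist (rotateTo e θ x) (rotateTo e η y) ≤ dist x y + 2 * |θ - η| := by
  have h : rotateTo e θ x - rotateTo e η y =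
      cos θ • (x - y) + ((cos θ - cos η) • y + (sin θ - sin η) • e) := by
    simp only [rotateTo]; module
  rw [dist_eq_norm, dist_eq_norm, h]
  have h1 : ‖cos θ • (x - y)‖ ≤ ‖x - y‖ := by
    rw [norm_smul]
    exact mul_le_of_le_one_left (norm_nonneg _) (abs_cos_le_one θ)
  have h2 : ‖(cos θ - cos η) • y‖ ≤ |θ - η| := by
    rw [norm_smul, hy, mul_one]; exact abs_cos_sub_cos_le θ η
  have h3 : ‖(sin θ - sin η) • e‖ ≤ |θ - η| := by
    rw [norm_smul, he, mul_one]; exact abs_sin_sub_sin_le θ η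
  linarith [norm_add_le (cos θ • (x - y)) ((cos θ - cos η) • y + (sin θ - sin η) • e),
    norm_add_le ((cos θ - cos η) • y) ((sin θ - sin η) • e)]

/-- A chain is encoded as an additive functional on cochains, with boundary `c ∘ coboundary`. Here
`c` plays the role of a finely subdivided hemisphere of dimension `k`: it only sees small tuples,
its boundary is antipodally symmetric, and the cup product takes the value 1 on it. The next
hemisphere is swept out by rotating `c` and its antipode to the new pole `e`. Its boundary is `c`
plus the antipode of `c`. -/
theorem exists_smallChain {N : ℕ} (p : ℕ → EuclideanSpace ℝ (Fin N) → ZMod 2)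
    (hp : ∀ i x, ‖x‖ = 1 → p i (-x) = p i x + 1) (k : ℕ) (hk : k < N) (ε : ℝ) (hε : 0 < ε) :
    ∃ c : (List (EuclideanSpace ℝ (Fin N)) → ZMod 2) →+ ZMod 2,
      (∀ φ ψ, (∀ l, IsSmallTuple (coordSphere N k) ε l → φ l = ψ l) → c φ = c ψ) ∧
      (∀ φ, c (coboundary fun l => φ (l.map fun x => -x)) = c (coboundary φ)) ∧
      c (cupCoboundaries p k) = 1 := by
  induction k generalizing ε with
  | zero =>
    let e : EuclideanSpace ℝ (Fin N) := EuclideanSpace.single ⟨0, hk⟩ 1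
    refine ⟨Pi.evalAddMonoidHom _ [e], fun φ ψ h => h _ ?_, fun φ => ?_, ?_⟩
    · intro x hx
      rw [List.mem_singleton.1 hx]
      refine ⟨⟨by simp [e], fun i hi => ?_⟩, fun y hy => ?_⟩
      · have : i ≠ ⟨0, hk⟩ := by rintro rfl; simp at hi
        simp [e, this]
      · rw [List.mem_singleton.1 hy, dist_self]
        exact hε
    · simp [coboundary]
    · simp [cupCoboundaries]
  | succ k ih =>
    -- The other half of `ε` is spent on the change of angle in one rotation step.
    obtain ⟨c, hc, hinv, hone⟩ := ih (by omega) (ε / 2) (by linarith)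
    let e : EuclideanSpace ℝ (Fin N) := EuclideanSpace.single ⟨k + 1, hk⟩ 1
    have he : ‖e‖ = 1 := by simp [e]
    -- A quarter turn in `M` steps moves the angle by `π / (2M)`. Twice this, the bound in
    -- `dist_rotateTo_le`, must be below `ε / 2`.
    obtain ⟨M, hM⟩ := exists_nat_gt (2 * π / ε)
    have hM0 : (0 : ℝ) < M := lt_trans (by positivity) hM
    let θ : ℕ → ℝ := fun j => j * (π / 2 / M)
    have hθ (j : ℕ) : 2 * |θ j - θ (j + 1)| < ε / 2 := by
      have h1 : θ j - θ (j + 1) = -(π / 2 / M) := by simp only [θ]; push_cast; ring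
      rw [h1, abs_neg, abs_of_pos (by positivity)]
      rw [div_lt_iff₀ hε] at hM
      rw [← mul_div_assoc, div_lt_iff₀ hM0]
      linarith
    let R := contraction (fun j => rotateTo e (θ j)) M e
    have hR (φ : List (EuclideanSpace ℝ (Fin N)) → ZMod 2) (l) :
        R (coboundary φ) l = φ l + coboundary (R φ) l := by
      apply coboundary_contraction
      · simp [rotateTo, θ]
      · have : θ M = π / 2 := by simp only [θ]; field_simp
        simp [rotateTo, this]
    have hsmall {φ ψ : List (EuclideanSpace ℝ (Fin N)) → ZMod 2}
        (h : ∀ l, IsSmallTuple (coordSphere N (k + 1)) ε l → φ l = ψ l)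
        {l : List (EuclideanSpace ℝ (Fin N))}
        (hl : IsSmallTuple (coordSphere N k) (ε / 2) l) : R φ l = R ψ l := by
      have hmem : e ∈ coordSphere N (k + 1) :=
        ⟨he, fun i hi => by
          have : i ≠ ⟨k + 1, hk⟩ := by rintro rfl; simp at hi
          simp [e, this]⟩
      have hdist {a b : ℝ} (hab : 2 * |a - b| < ε / 2) {x y} (hx : x ∈ l) (hy : y ∈ l) :
          dist (rotateTo e a x) (rotateTo e b y) < ε := by
        have := dist_rotateTo_le (x := x) he (hl y hy).1.1 a b
        linarith [(hl x hx).2 y hy]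
      have h00 (a : ℝ) : 2 * |a - a| < ε / 2 := by simpa using hε
      simp only [R, contraction]
      congr 1
      · refine Finset.sum_congr rfl fun j _ => prism_congr fun l' hl' => h l' fun y hy => ?_
        obtain ⟨x, hx, hxy⟩ := hl' y hy
        constructor
        · rcases hxy with rfl | rfl
          · exact rotateTo_mem hk _ (hl x hx).1
          · exact rotateTo_mem hk _ (hl x hx).1
        · intro y' hy'
          obtain ⟨x', hx', hxy'⟩ := hl' y' hy'
          rcases hxy with rfl | rfl <;> rcases hxy' with rfl | rfl
          · exact hdist (h00 _) hx hx'
          · exact hdist (hθ j) hx hx'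
          · rw [dist_comm]; exact hdist (hθ j) hx' hx
          · exact hdist (h00 _) hx hx'
      · have hall : ∀ x ∈ e :: l.map fun _ => e, x = e := by simp
        refine h _ fun x hx => ?_
        rw [hall x hx]
        refine ⟨hmem, fun y hy => ?_⟩
        rw [hall y hy, dist_self]
        exact hε
    -- The boundary of `c` is symmetric, so it cancels against its antipode mod 2.
    have hz (ψ : List (EuclideanSpace ℝ (Fin N)) → ZMod 2) :
        c (coboundary ψ) + c (fun l => coboundary ψ (l.map fun x => -x)) = 0 := by
      have : (fun l => coboundary ψ (l.map fun x => -x)) =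
          coboundary fun l => ψ (l.map fun x => -x) := funext fun l => (coboundary_map _ ψ l).symm
      rw [this, hinv]
      linear_combination c (coboundary ψ) * two_eq_zero_zmod
    let c' : (List (EuclideanSpace ℝ (Fin N)) → ZMod 2) →+ ZMod 2 := AddMonoidHom.mk'
      (fun φ => c (R φ) + c (fun l => R φ (l.map fun x => -x))) (fun φ ψ => by
        have h1 : R (φ + ψ) = R φ + R ψ := funext fun l => contraction_add _ _ _ φ ψ l
        have h2 : (fun l : List (EuclideanSpace ℝ (Fin N)) => (R φ + R ψ) (l.map fun x => -x)) =
          (fun l : List (EuclideanSpace ℝ (Fin N)) => R φ (l.map fun x => -x)) +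
            fun l : List (EuclideanSpace ℝ (Fin N)) => R ψ (l.map fun x => -x) := rfl
        simp only [h1, h2, map_add]
        ring)
    have hbd (φ : List (EuclideanSpace ℝ (Fin N)) → ZMod 2) :
        c' (coboundary φ) = c φ + c (fun l => φ (l.map fun x => -x)) := by
      have h1 : R (coboundary φ) = φ + coboundary (R φ) := funext (hR φ)
      have h2 : (fun l : List (EuclideanSpace ℝ (Fin N)) => (φ + coboundary (R φ)) (l.map fun x => -x)) =
          (fun l : List (EuclideanSpace ℝ (Fin N)) => φ (l.map fun x => -x)) +
            fun l : List (EuclideanSpace ℝ (Fin N)) => coboundary (R φ) (l.map fun x => -x) := rfl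
      have h3 : c' (coboundary φ) =
        c (R (coboundary φ)) + c (fun l => R (coboundary φ) (l.map fun x => -x)) := rfl
      rw [h3, h1, h2, map_add, map_add]
      linear_combination hz (R φ)
    refine ⟨c', fun φ ψ h => ?_, fun φ => ?_, ?_⟩
    · exact congrArg₂ (· + ·) (hc _ _ fun l hl => hsmall h hl)
        (hc _ _ fun l hl => hsmall h hl.map_neg)
    · rw [hbd, hbd, add_comm]
      simp
    -- The antipode turns `p k ∪ φ` into `p k ∪ φ + φ`, for `φ` the `k`-fold product. The two sides
    -- of the boundary therefore add up to `c φ = 1`.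
    · rw [cupCoboundaries, hbd, hc (fun l => headMul (p k) (cupCoboundaries p k) (l.map fun x => -x))
        (headMul (p k) (cupCoboundaries p k) + cupCoboundaries p k), map_add, hone]
      · linear_combination c (headMul (p k) (cupCoboundaries p k)) * two_eq_zero_zmod
      · intro l hl
        exact headMul_map _ _ (cupCoboundaries_nil p k) (fun x hx => hp k x (hl x hx).1.1)
          (cupCoboundaries_map (S := coordSphere N k) p (fun i x hx => hp i x hx.1) k
            fun x hx => (hl x hx).1)

/-- One point is chosen from each pair `{x, -x}`. This breaks ties where a coordinate of an odd map
vanishes. -/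
theorem exists_odd_predicate (E : Type*) [AddCommGroup E] [Module ℝ E] :
    ∃ s : E → Prop, ∀ x, x ≠ 0 → (s (-x) ↔ ¬ s x) := by
  let q : E → E := fun x => (Quot.out s(x, -x)).1
  have hq (x : E) : q x = x ∨ q x = -x := by
    have h1 : q x ∈ s(x, -x) := Sym2.out_fst_mem _
    simpa using h1
  have hneg (x : E) : q (-x) = q x := by
    simp only [q, neg_neg]
    rw [Sym2.eq_swap]
  refine ⟨fun x => q x = x, fun x hx => ?_⟩
  have hne : x ≠ -x := fun h => hx (by
    have h2 : (2 : ℝ) • x = 0 := by rw [two_smul]; nth_rw 2 [h]; exact add_neg_cancel x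
    exact (smul_eq_zero.1 h2).resolve_left two_ne_zero)
  change q (-x) = -x ↔ ¬ q x = x
  rw [hneg]
  constructor
  · intro h h'
    exact hne (h'.symm.trans h)
  · exact fun h => (hq x).resolve_left h

/-- The **Borsuk–Ulam theorem**. -/
theorem borsuk_ulam {m N : ℕ} (hmN : m < N) (f : EuclideanSpace ℝ (Fin N) → Fin m → ℝ)
    (hf : ContinuousOn f (Metric.sphere 0 1)) : ∃ x, ‖x‖ = 1 ∧ f (-x) = f x := by
  classical
  by_contra! hcon
  let h : EuclideanSpace ℝ (Fin N) → Fin m → ℝ := fun x => f x - f (-x)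
  have hodd (x) (i) : h (-x) i = -h x i := by simp [h]
  have hcont : ContinuousOn h (Metric.sphere 0 1) :=
    hf.sub (hf.comp continuous_neg.continuousOn fun x hx => by simpa using hx)
  have hcpt : IsCompact (Metric.sphere (0 : EuclideanSpace ℝ (Fin N)) 1) := isCompact_sphere 0 1
  obtain ⟨x₀, hx₀, hmin⟩ := hcpt.exists_isMinOn
    ⟨EuclideanSpace.single ⟨0, by omega⟩ 1, by simp⟩ hcont.norm
  have hη : 0 < ‖h x₀‖ := by
    rw [norm_pos_iff, sub_ne_zero]
    exact (hcon x₀ (by simpa using hx₀)).symm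
  obtain ⟨δ, hδ, huc⟩ := Metric.uniformContinuousOn_iff.1
    (hcpt.uniformContinuousOn_of_continuous hcont) ‖h x₀‖ hη
  obtain ⟨s, hs⟩ := exists_odd_predicate (EuclideanSpace ℝ (Fin N))
  -- The signs of the coordinates of `h`, with `s` deciding at zeros so that `p i` is odd
  -- everywhere. Indices from `m` on only serve to make `p` total.
  let p : ℕ → EuclideanSpace ℝ (Fin N) → ZMod 2 := fun i x =>
    if hi : i < m then
      if 0 < h x ⟨i, hi⟩ ∨ (h x ⟨i, hi⟩ = 0 ∧ s x) then 1 else 0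
    else if s x then 1 else 0
  have hp (i x) (hx : ‖x‖ = 1) : p i (-x) = p i x + 1 := by
    have hsx := hs x (norm_pos_iff.1 (by rw [hx]; exact one_pos))
    have h11 : (0 : ZMod 2) = 1 + 1 := rfl
    simp only [p, hodd]
    split_ifs with h1 h2 h3 h4 h5 h6 <;> grind
  obtain ⟨c, hc, -, hone⟩ := exists_smallChain p hp m hmN δ hδ
  -- On a `δ`-small tuple some coordinate of `h` is at least the minimal norm at one point and
  -- varies by less than that. Its sign is then constant on the tuple, and the product vanishes
  -- there.
  have hzero : c (cupCoboundaries p m) = c 0 := by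
    refine hc _ _ fun l hl => ?_
    rcases l with _ | ⟨x, l⟩
    · exact cupCoboundaries_nil p m
    have hmem : ∀ y ∈ x :: l, y ∈ Metric.sphere (0 : EuclideanSpace ℝ (Fin N)) 1 :=
      fun y hy => by simpa using (hl y hy).1.1
    obtain ⟨i, hi⟩ : ∃ i, ‖h x₀‖ ≤ |h x i| := by
      by_contra! hlt
      have h1 := hmin (hmem x (by simp))
      exact absurd ((pi_norm_lt_iff hη).2 hlt) (not_lt.2 h1)
    have hclose : ∀ y ∈ x :: l, |h x i - h y i| < ‖h x₀‖ := fun y hy =>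
      lt_of_le_of_lt (dist_le_pi_dist (h x) (h y) i)
        (huc x (hmem x (by simp)) y (hmem y hy) ((hl x (by simp)).2 y hy))
    refine cupCoboundaries_eq_zero p i.2 (S := {y | y ∈ x :: l}) (a := if 0 < h x i then 1 else 0)
      (fun y hy => ?_) fun y hy => hy
    have h1 := abs_lt.1 (hclose y hy)
    have h2 : p i y = if 0 < h y i ∨ (h y i = 0 ∧ s y) then 1 else 0 := by simp [p]
    rw [h2]
    rcases le_abs.1 hi with h3 | h3
    · rw [if_pos (Or.inl (by linarith)), if_pos (by linarith)]
    · rw [if_neg (by rintro (h4 | ⟨h4, -⟩) <;> linarith), if_neg (by linarith)]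
  rw [hone, map_zero] at hzero
  exact one_ne_zero hzero

end BorsukUlam

/-! ### Injective maps between spheres -/

section Spheres

theorem continuous_extend_sphere {N : ℕ} {F : Type*} [TopologicalSpace F] [Zero F]
    {g : Metric.sphere (0 : EuclideanSpace ℝ (Fin N)) 1 → F} (hg : Continuous g) :
    ContinuousOn (Function.extend Subtype.val g 0) (Metric.sphere 0 1) := by
  rw [continuousOn_iff_continuous_domRestrict]
  convert hg using 1
  funext x
  exact Subtype.val_injective.extend_apply g 0 x

theorem exists_eq_neg_of_sphere_map {m N : ℕ} (hmN : m < N)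
    {g : Metric.sphere (0 : EuclideanSpace ℝ (Fin N)) 1 → EuclideanSpace ℝ (Fin m)}
    (hg : Continuous g) : ∃ x, g (-x) = g x := by
  have hg' : Continuous fun x => WithLp.ofLp (g x) := by fun_prop
  obtain ⟨x, hx, hfx⟩ := borsuk_ulam hmN _ (continuous_extend_sphere hg')
  have hx' : x ∈ Metric.sphere (0 : EuclideanSpace ℝ (Fin N)) 1 := by simpa using hx
  have h1 := Subtype.val_injective.extend_apply (fun x => WithLp.ofLp (g x)) 0 ⟨x, hx'⟩
  have h2 := Subtype.val_injective.extend_apply (fun x => WithLp.ofLp (g x)) 0 (-⟨x, hx'⟩)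
  refine ⟨⟨x, hx'⟩, WithLp.ofLp_injective 2 ?_⟩
  exact h2.symm.trans (hfx.trans h1)

theorem sphere_neg_ne {N : ℕ} (x : Metric.sphere (0 : EuclideanSpace ℝ (Fin N)) 1) : -x ≠ x :=
  fun h => ne_neg_of_mem_unit_sphere ℝ x h.symm

theorem dim_le_of_injective_sphere_map {a b : ℕ}
    {g : Metric.sphere (0 : EuclideanSpace ℝ (Fin a)) 1 →
      Metric.sphere (0 : EuclideanSpace ℝ (Fin b)) 1}
    (hg : Continuous g) (hinj : Function.Injective g) : a ≤ b := by
  by_contra! hab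
  obtain ⟨x, hx⟩ := exists_eq_neg_of_sphere_map hab (continuous_subtype_val.comp hg)
  exact sphere_neg_ne x (hinj (Subtype.val_injective hx))

/-- If a point were missed, stereographic projection from it would give an injective map to a
Euclidean space of one dimension less than the ambient one, against Borsuk–Ulam. -/
theorem surjective_of_injective_sphere_map {a : ℕ}
    {g : Metric.sphere (0 : EuclideanSpace ℝ (Fin a)) 1 →
      Metric.sphere (0 : EuclideanSpace ℝ (Fin a)) 1}
    (hg : Continuous g) (hinj : Function.Injective g) : Function.Surjective g := by
  intro q
  by_contra! hq
  match a with
  | 0 =>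
    have h := q.2
    rw [Subsingleton.elim (q : EuclideanSpace ℝ (Fin 0)) 0] at h
    simp at h
  | a + 1 =>
    have : Fact (Module.finrank ℝ (EuclideanSpace ℝ (Fin (a + 1))) = a + 1) :=
      ⟨finrank_euclideanSpace_fin⟩
    have hsource (x) : g x ∈ (stereographic' a q).source := by
      rw [stereographic'_source]
      exact hq x
    obtain ⟨x, hx⟩ := exists_eq_neg_of_sphere_map (Nat.lt_succ_self a)
      ((stereographic' a q).continuousOn.comp_continuous hg hsource)
    exact sphere_neg_ne x (hinj ((stereographic' a q).injOn (hsource _) (hsource _) hx))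

end Spheres

/-! ### Geometric realizations and spherical subcomplexes -/

namespace PreAbstractSimplicialComplex

variable {V : Type*} {W : Type*} [Fintype V] [Fintype W]

theorem mem_faces_of_subset {V : Type*} {K : PreAbstractSimplicialComplex V} {F G : Finset V}
    (hF : F ∈ K.faces) (hG : G ⊆ F) (hne : G.Nonempty) : G ∈ K.faces :=
  (K.isRelLowerSet_faces hF).2 hG hne

theorem nonempty_of_mem_faces {V : Type*} {K : PreAbstractSimplicialComplex V} {F : Finset V}
    (hF : F ∈ K.faces) : F.Nonempty :=
  (K.isRelLowerSet_faces hF).1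

theorem realization_mono {K L : PreAbstractSimplicialComplex V} (h : K.faces ⊆ L.faces) :
    K.realization ⊆ L.realization :=
  fun _ ⟨hp, F, hF, hFp⟩ => ⟨hp, F, h hF, hFp⟩

/-- The barycentre of a face lies only in the simplices that contain that face. -/
theorem faces_subset_of_realization_subset {K L : PreAbstractSimplicialComplex V}
    (h : K.realization ⊆ L.realization) : K.faces ⊆ L.faces := by
  classical
  intro F hF
  have hne := nonempty_of_mem_faces hF
  have hcard : (0 : ℝ) < F.card := by exact_mod_cast hne.card_pos
  have hp : (fun x => if x ∈ F then (F.card : ℝ)⁻¹ else 0) ∈ K.realization := by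
    refine ⟨⟨fun x => ?_, ?_⟩, F, hF, fun x hx => if_neg hx⟩
    · dsimp only
      split_ifs <;> positivity
    · simp [hcard.ne']
  obtain ⟨-, G, hG, hGp⟩ := h hp
  refine mem_faces_of_subset hG (fun x hx => ?_) hne
  by_contra hxG
  have := hGp x hxG
  simp only [if_pos hx] at this
  exact hcard.ne' (inv_eq_zero.1 this)

theorem IsSphereIn.le_of_faces_subset {a b : ℕ} {K L : PreAbstractSimplicialComplex V}
    (hK : K.IsSphereIn a) (hL : L.IsSphereIn b) (h : K.faces ⊆ L.faces) : a ≤ b := by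
  obtain ⟨φ⟩ := hK
  obtain ⟨ψ⟩ := hL
  exact dim_le_of_injective_sphere_map
    (g := ψ ∘ Set.inclusion (realization_mono h) ∘ φ.symm)
    (ψ.continuous.comp ((continuous_inclusion _).comp φ.symm.continuous))
    (ψ.injective.comp ((Set.inclusion_injective _).comp φ.symm.injective))

theorem IsSphereIn.eq_of_faces_subset {a : ℕ} {K L : PreAbstractSimplicialComplex V}
    (hK : K.IsSphereIn a) (hL : L.IsSphereIn a) (h : K.faces ⊆ L.faces) : K = L := by
  obtain ⟨φ⟩ := hK
  obtain ⟨ψ⟩ := hL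
  have hsurj := surjective_of_injective_sphere_map
    (g := ψ ∘ Set.inclusion (realization_mono h) ∘ φ.symm)
    (ψ.continuous.comp ((continuous_inclusion _).comp φ.symm.continuous))
    (ψ.injective.comp ((Set.inclusion_injective _).comp φ.symm.injective))
  refine PreAbstractSimplicialComplex.ext
    (h.antisymm (faces_subset_of_realization_subset fun p hp => ?_))
  obtain ⟨x, hx⟩ := hsurj (ψ ⟨p, hp⟩)
  have h1 := congrArg Subtype.val (ψ.injective hx)
  change (φ.symm x : V → ℝ) = p at h1
  rw [← h1]
  exact (φ.symm x).2

theorem IsSphereIn.eq_zero {k : ℕ} {K : PreAbstractSimplicialComplex V} (hK : K.IsSphereIn k)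
    (h : K.faces = ∅) : k = 0 := by
  obtain ⟨φ⟩ := hK
  by_contra hk
  obtain ⟨-, F, hF, -⟩ := (φ.symm ⟨EuclideanSpace.single ⟨0, Nat.pos_of_ne_zero hk⟩ 1, by simp⟩).2
  rw [h] at hF
  exact hF

/-- Barycentric coordinates are extended by zero along `i`. The target may have points outside the
range of `i`, as happens when a join has an empty factor. -/
theorem realization_homeomorph_of_map {K : PreAbstractSimplicialComplex V}
    {L : PreAbstractSimplicialComplex W} (i : V ↪ W)
    (h : ∀ F, F ∈ L.faces ↔ ∃ G ∈ K.faces, G.map i = F) :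
    Nonempty (K.realization ≃ₜ L.realization) := by
  classical
  have hnot {q : W → ℝ} (hq : q ∈ L.realization) {w : W} (hw : w ∉ Set.range i) : q w = 0 := by
    obtain ⟨-, F, hF, hFq⟩ := hq
    obtain ⟨G, -, rfl⟩ := (h F).1 hF
    refine hFq w fun hwF => hw ?_
    obtain ⟨v, -, rfl⟩ := Finset.mem_map.1 hwF
    exact ⟨v, rfl⟩
  have hsum (q : W → ℝ) (hq : ∀ w ∉ Set.range i, q w = 0) : ∑ v, q (i v) = ∑ w, q w := by
    rw [← Finset.sum_map Finset.univ i q]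
    refine Finset.sum_subset (Finset.subset_univ _) fun w _ hw => hq w ?_
    rintro ⟨v, rfl⟩
    exact hw (by simp)
  have happ (p : V → ℝ) (v : V) : Function.extend i p 0 (i v) = p v := i.injective.extend_apply _ _ _
  have hext (p : V → ℝ) (w : W) (hw : w ∉ Set.range i) : Function.extend i p 0 w = 0 :=
    Function.extend_apply' _ _ _ hw
  refine ⟨{
    toFun := fun p => ⟨Function.extend i p 0, ?_⟩
    invFun := fun q => ⟨fun v => (q : W → ℝ) (i v), ?_⟩
    left_inv := fun p => Subtype.ext (funext fun v => happ _ v)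
    right_inv := fun q => Subtype.ext (funext fun w => ?_)
    continuous_toFun := ?_
    continuous_invFun := ?_ }⟩
  · obtain ⟨p, ⟨hp0, hp1⟩, F, hF, hFp⟩ := p
    refine ⟨⟨fun w => ?_, ?_⟩, F.map i, (h _).2 ⟨F, hF, rfl⟩, fun w hw => ?_⟩
    · by_cases hw : w ∈ Set.range i
      · obtain ⟨v, rfl⟩ := hw
        simpa only [happ] using hp0 v
      · exact (hext p w hw).ge
    · rw [← hsum _ (hext p)]
      simpa only [happ] using hp1
    · by_cases hw' : w ∈ Set.range i
      · obtain ⟨v, rfl⟩ := hw'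
        simpa only [happ] using hFp v fun hv => hw (Finset.mem_map_of_mem i hv)
      · exact hext p w hw'
  · obtain ⟨q, hq⟩ := q
    obtain ⟨⟨hq0, hq1⟩, F, hF, hFq⟩ := id hq
    obtain ⟨G, hG, rfl⟩ := (h F).1 hF
    refine ⟨⟨fun v => hq0 _, ?_⟩, G, hG, fun v hv => hFq _ (by simpa using hv)⟩
    rw [hsum q fun w hw => hnot hq hw]
    exact hq1
  · by_cases hw : w ∈ Set.range i
    · obtain ⟨v, rfl⟩ := hw
      exact happ _ v
    · exact (hext _ w hw).trans (hnot q.2 hw).symm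
  · refine Continuous.subtype_mk (continuous_pi fun w => ?_) _
    by_cases hw : w ∈ Set.range i
    · obtain ⟨v, rfl⟩ := hw
      simp only [happ]
      exact (continuous_apply v).comp continuous_subtype_val
    · simp only [hext _ w hw]
      exact continuous_const
  · exact Continuous.subtype_mk
      (continuous_pi fun v => (continuous_apply (A := fun _ => ℝ) (i v)).comp
        continuous_subtype_val) _

theorem isSphereIn_iff_of_map {K : PreAbstractSimplicialComplex V}
    {L : PreAbstractSimplicialComplex W} (i : V ↪ W)
    (h : ∀ F, F ∈ L.faces ↔ ∃ G ∈ K.faces, G.map i = F) (k : ℕ) :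
    L.IsSphereIn k ↔ K.IsSphereIn k := by
  obtain ⟨e⟩ := realization_homeomorph_of_map i h
  exact ⟨fun ⟨φ⟩ => ⟨e.trans φ⟩, fun ⟨φ⟩ => ⟨e.symm.trans φ⟩⟩

end PreAbstractSimplicialComplex

/-! ### Joins of spheres -/

namespace PreAbstractSimplicialComplex

variable {V : Type*} {W : Type*} [Fintype V] [Fintype W]

/-- The cone over the geometric realization, in the nonnegative orthant. -/
def realizationCone (K : PreAbstractSimplicialComplex V) : Set (V → ℝ) :=
  {p | (∀ x, 0 ≤ p x) ∧ ∃ F, (F = ∅ ∨ F ∈ K.faces) ∧ ∀ x, x ∉ F → p x = 0}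

/-- Away from the origin this is a composition of continuous maps. At the origin, `g` is bounded by
compactness and the factor `‖x‖ ^ 2` tends to zero. -/
theorem continuous_radial {a : ℕ} {F : Type*} [NormedAddCommGroup F] [NormedSpace ℝ F]
    {g : EuclideanSpace ℝ (Fin a) → F} (hg : ContinuousOn g (Metric.sphere 0 1)) :
    Continuous fun x => ‖x‖ ^ 2 • g (‖x‖⁻¹ • x) := by
  obtain ⟨C, hC⟩ := (isCompact_sphere (0 : EuclideanSpace ℝ (Fin a)) 1).exists_bound_of_continuousOn hg
  have hmem {x : EuclideanSpace ℝ (Fin a)} (hx : x ≠ 0) : ‖x‖⁻¹ • x ∈ Metric.sphere 0 1 := by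
    rw [mem_sphere_zero_iff_norm, norm_smul, norm_inv, norm_norm]
    exact inv_mul_cancel₀ (norm_ne_zero_iff.2 hx)
  rw [continuous_iff_continuousAt]
  intro x
  by_cases hx : x = 0
  · subst hx
    have h0 : Filter.Tendsto (fun x : EuclideanSpace ℝ (Fin a) => ‖x‖ ^ 2 * C) (nhds 0) (nhds 0) := by
      have : Continuous fun x : EuclideanSpace ℝ (Fin a) => ‖x‖ ^ 2 * C := by fun_prop
      simpa using this.tendsto 0
    rw [ContinuousAt, norm_zero, sq, zero_mul, zero_smul]
    refine squeeze_zero_norm (fun x => ?_) h0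
    by_cases hx : x = 0
    · simp [hx]
    · rw [norm_smul, norm_pow, norm_norm]
      exact mul_le_mul_of_nonneg_left (hC _ (hmem hx)) (by positivity)
  · have hopen : IsOpen {x : EuclideanSpace ℝ (Fin a) | x ≠ 0} := isOpen_ne
    refine ContinuousOn.continuousAt (s := {x | x ≠ 0}) ?_ (hopen.mem_nhds hx)
    have hinv : ContinuousOn (fun x : EuclideanSpace ℝ (Fin a) => ‖x‖⁻¹ • x) {x | x ≠ 0} :=
      (continuous_norm.continuousOn.inv₀ fun x hx => norm_ne_zero_iff.2 hx).smul continuousOn_id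
    exact ContinuousOn.smul (by fun_prop) (hg.comp hinv fun x hx => hmem hx)

/-- The homeomorphism with the sphere is extended radially. The scaling is quadratic so that
coordinate sums become squared norms: the condition that all coordinates of a point of the join sum
to 1 then becomes the equation of the unit sphere. -/
theorem IsSphereIn.exists_radial {a : ℕ} {K : PreAbstractSimplicialComplex V}
    (hK : K.IsSphereIn a) : ∃ R : EuclideanSpace ℝ (Fin a) → V → ℝ, Continuous R ∧
      Function.Injective R ∧ (∀ x, ∑ v, R x v = ‖x‖ ^ 2) ∧ Set.range R = K.realizationCone := by
  obtain ⟨φ⟩ := hK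
  let g : Metric.sphere (0 : EuclideanSpace ℝ (Fin a)) 1 → V → ℝ := fun y => φ.symm y
  have hg : Continuous g := continuous_subtype_val.comp φ.symm.continuous
  let R : EuclideanSpace ℝ (Fin a) → V → ℝ := fun x =>
    ‖x‖ ^ 2 • Function.extend Subtype.val g 0 (‖x‖⁻¹ • x)
  have hR0 : R 0 = 0 := by simp [R]
  have hRpos {x : EuclideanSpace ℝ (Fin a)} (hx : x ≠ 0) :
      ∃ y : Metric.sphere (0 : EuclideanSpace ℝ (Fin a)) 1, ‖x‖⁻¹ • x = y ∧ R x = ‖x‖ ^ 2 • g y := by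
    have hy : ‖x‖⁻¹ • x ∈ Metric.sphere (0 : EuclideanSpace ℝ (Fin a)) 1 := by
      rw [mem_sphere_zero_iff_norm, norm_smul, norm_inv, norm_norm]
      exact inv_mul_cancel₀ (norm_ne_zero_iff.2 hx)
    exact ⟨⟨_, hy⟩, rfl, congrArg (‖x‖ ^ 2 • ·) (Subtype.val_injective.extend_apply g 0 ⟨_, hy⟩)⟩
  have hsum (x) : ∑ v, R x v = ‖x‖ ^ 2 := by
    by_cases hx : x = 0
    · simp [hx, hR0]
    · obtain ⟨y, -, hy⟩ := hRpos hx
      have h1 : ∑ v, g y v = 1 := (φ.symm y).2.1.2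
      simp only [hy, Pi.smul_apply, smul_eq_mul, ← Finset.mul_sum, h1, mul_one]
  refine ⟨R, continuous_radial (continuous_extend_sphere hg), fun x x' h => ?_, hsum, ?_⟩
  · have hnorm : ‖x‖ = ‖x'‖ := by
      have h1 := hsum x
      rw [h, hsum x'] at h1
      exact ((sq_eq_sq₀ (norm_nonneg _) (norm_nonneg _)).1 h1).symm
    by_cases hx : x = 0
    · rw [hx, norm_zero] at hnorm
      rw [hx, norm_eq_zero.1 hnorm.symm]
    · have hx' : x' ≠ 0 := norm_ne_zero_iff.1 (hnorm ▸ norm_ne_zero_iff.2 hx)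
      obtain ⟨y, hxy, hy⟩ := hRpos hx
      obtain ⟨y', hxy', hy'⟩ := hRpos hx'
      have hne := norm_ne_zero_iff.2 hx'
      rw [hy, hy', hnorm] at h
      have h2 : g y = g y' := smul_right_injective _ (pow_ne_zero 2 hne) h
      have h3 : y = y' := φ.symm.injective (Subtype.val_injective h2)
      rw [hnorm, h3, ← hxy'] at hxy
      exact smul_right_injective _ (inv_ne_zero hne) hxy
  · ext p
    constructor
    · rintro ⟨x, rfl⟩
      by_cases hx : x = 0
      · rw [hx, hR0]
        exact ⟨fun _ => le_rfl, ∅, Or.inl rfl, fun _ _ => rfl⟩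
      · obtain ⟨y, -, hy⟩ := hRpos hx
        obtain ⟨⟨h0, -⟩, F, hF, hFp⟩ := (φ.symm y).2
        rw [hy]
        refine ⟨fun v => mul_nonneg (by positivity) (h0 v), F, Or.inr hF, fun v hv => ?_⟩
        change ‖x‖ ^ 2 * (φ.symm y : V → ℝ) v = 0
        rw [hFp v hv, mul_zero]
    · rintro ⟨hp0, F, hF, hFp⟩
      have ht0 : 0 ≤ ∑ v, p v := Finset.sum_nonneg fun v _ => hp0 v
      rcases ht0.eq_or_lt with ht | ht
      · refine ⟨0, hR0.trans (funext fun v => ?_)⟩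
        exact ((Finset.sum_eq_zero_iff_of_nonneg fun v _ => hp0 v).1 ht.symm v (Finset.mem_univ v)).symm
      · set t := ∑ v, p v with ht_def
        have hFK : F ∈ K.faces := by
          refine hF.resolve_left ?_
          rintro rfl
          rw [ht_def, Finset.sum_eq_zero fun v _ => hFp v (Finset.notMem_empty v)] at ht
          exact lt_irrefl 0 ht
        have hq : t⁻¹ • p ∈ K.realization := by
          refine ⟨⟨fun v => mul_nonneg (inv_nonneg.2 ht0) (hp0 v), ?_⟩, F, hFK, fun v hv => ?_⟩
          · simp only [Pi.smul_apply, smul_eq_mul, ← Finset.mul_sum]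
            exact inv_mul_cancel₀ ht.ne'
          · change t⁻¹ * p v = 0
            rw [hFp v hv, mul_zero]
        -- The preimage of `p` has direction `y` and norm `√t`, because the radial map squares
        -- norms.
        let y := φ ⟨_, hq⟩
        have hy : ‖(y : EuclideanSpace ℝ (Fin a))‖ = 1 := mem_sphere_zero_iff_norm.1 y.2
        have hst : 0 < Real.sqrt t := Real.sqrt_pos.2 ht
        have hnorm : ‖Real.sqrt t • (y : EuclideanSpace ℝ (Fin a))‖ = Real.sqrt t := by
          rw [norm_smul, hy, mul_one, Real.norm_eq_abs, abs_of_pos hst]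
        have hne : Real.sqrt t • (y : EuclideanSpace ℝ (Fin a)) ≠ 0 := by
          rw [← norm_ne_zero_iff, hnorm]
          exact hst.ne'
        obtain ⟨z, hz, hRz⟩ := hRpos hne
        rw [hnorm, smul_smul, inv_mul_cancel₀ hst.ne', one_smul] at hz
        refine ⟨_, hRz.trans ?_⟩
        rw [hnorm, Real.sq_sqrt ht0, ← Subtype.val_injective hz]
        have : g y = t⁻¹ • p := congrArg Subtype.val (φ.symm_apply_apply ⟨_, hq⟩)
        rw [this, smul_smul, mul_inv_cancel₀ ht.ne', one_smul]

theorem mem_realization_join_iff {K : PreAbstractSimplicialComplex V}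
    {L : PreAbstractSimplicialComplex W} {p : V → ℝ} {q : W → ℝ} :
    Sum.elim p q ∈ (K.join L).realization ↔
      p ∈ K.realizationCone ∧ q ∈ L.realizationCone ∧ ∑ v, p v + ∑ w, q w = 1 := by
  classical
  constructor
  · rintro ⟨⟨h0, h1⟩, F, ⟨-, hK, hL⟩, hFp⟩
    rw [Fintype.sum_sum_type] at h1
    exact ⟨⟨fun v => h0 (Sum.inl v), _, hK, fun v hv => hFp (Sum.inl v) (by simpa using hv)⟩,
      ⟨fun w => h0 (Sum.inr w), _, hL, fun w hw => hFp (Sum.inr w) (by simpa using hw)⟩, h1⟩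
  · rintro ⟨⟨hp0, F, hF, hFp⟩, ⟨hq0, G, hG, hGq⟩, h1⟩
    have hz : ∀ x, x ∉ F.disjSum G → Sum.elim p q x = 0 := by
      rintro (v | w) h
      · exact hFp v (by simpa using h)
      · exact hGq w (by simpa using h)
    have hs : ∑ x, Sum.elim p q x = 1 := by
      rw [Fintype.sum_sum_type]
      exact h1
    refine ⟨⟨fun x => ?_, hs⟩, F.disjSum G, ⟨?_, ?_, ?_⟩, hz⟩
    · cases x
      · exact hp0 _
      · exact hq0 _
    · by_contra hne
      rw [Finset.not_nonempty_iff_eq_empty] at hne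
      rw [Finset.sum_eq_zero fun x _ => hz x (by simp [hne])] at hs
      exact zero_ne_one hs
    · simpa using hF
    · simpa using hG

/-- The join of simplicial spheres is a simplicial sphere. -/
theorem IsSphereIn.join {a b : ℕ} {K : PreAbstractSimplicialComplex V}
    {L : PreAbstractSimplicialComplex W} (hK : K.IsSphereIn a) (hL : L.IsSphereIn b) :
    (K.join L).IsSphereIn (a + b) := by
  obtain ⟨R, hRc, hRi, hRs, hRr⟩ := hK.exists_radial
  obtain ⟨S, hSc, hSi, hSs, hSr⟩ := hL.exists_radial
  let π₁ : EuclideanSpace ℝ (Fin (a + b)) → EuclideanSpace ℝ (Fin a) :=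
    fun x => WithLp.toLp 2 fun i => x (Fin.castAdd b i)
  let π₂ : EuclideanSpace ℝ (Fin (a + b)) → EuclideanSpace ℝ (Fin b) :=
    fun x => WithLp.toLp 2 fun i => x (Fin.natAdd a i)
  have hπ₁ : Continuous π₁ := by fun_prop
  have hπ₂ : Continuous π₂ := by fun_prop
  have hnorm (x) : ‖π₁ x‖ ^ 2 + ‖π₂ x‖ ^ 2 = ‖x‖ ^ 2 := by
    simp only [EuclideanSpace.norm_sq_eq, Fin.sum_univ_add, π₁, π₂]
  have hinj {x y} (h₁ : π₁ x = π₁ y) (h₂ : π₂ x = π₂ y) : x = y := by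
    ext i
    refine Fin.addCases (fun i => ?_) (fun i => ?_) i
    · exact congrFun (congrArg WithLp.ofLp h₁) i
    · exact congrFun (congrArg WithLp.ofLp h₂) i
  let Θ : Metric.sphere (0 : EuclideanSpace ℝ (Fin (a + b))) 1 → (K.join L).realization := fun x =>
    ⟨Sum.elim (R (π₁ x)) (S (π₂ x)), mem_realization_join_iff.2
      ⟨hRr ▸ Set.mem_range_self _, hSr ▸ Set.mem_range_self _, by
        rw [hRs, hSs, hnorm, mem_sphere_zero_iff_norm.1 x.2, one_pow]⟩⟩
  have hΘc : Continuous Θ := by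
    refine Continuous.subtype_mk (continuous_pi fun x => ?_) _
    cases x with
    | inl v => exact (continuous_apply v).comp (hRc.comp (hπ₁.comp continuous_subtype_val))
    | inr w => exact (continuous_apply w).comp (hSc.comp (hπ₂.comp continuous_subtype_val))
  have hΘ : Function.Bijective Θ := by
    constructor
    · intro x y h
      have h' := congrArg Subtype.val h
      exact Subtype.val_injective (hinj (hRi (funext fun v => congrFun h' (Sum.inl v)))
        (hSi (funext fun w => congrFun h' (Sum.inr w))))
    · rintro ⟨r, hr⟩
      have hr' : Sum.elim (r ∘ Sum.inl) (r ∘ Sum.inr) = r := Sum.elim_comp_inl_inr r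
      obtain ⟨hp, hq, h1⟩ := mem_realization_join_iff.1 (hr'.symm ▸ hr)
      rw [← hRr] at hp
      rw [← hSr] at hq
      obtain ⟨x, hx⟩ := hp
      obtain ⟨y, hy⟩ := hq
      let z : EuclideanSpace ℝ (Fin (a + b)) := WithLp.toLp 2 (Fin.append x y)
      have hz₁ : π₁ z = x := by ext i; simp [π₁, z]
      have hz₂ : π₂ z = y := by ext i; simp [π₂, z]
      have hz : z ∈ Metric.sphere (0 : EuclideanSpace ℝ (Fin (a + b))) 1 := by
        rw [mem_sphere_zero_iff_norm, ← pow_eq_one_iff_of_nonneg (norm_nonneg z) two_ne_zero,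
          ← hnorm, hz₁, hz₂, ← hRs, ← hSs, hx, hy]
        exact h1
      refine ⟨⟨z, hz⟩, Subtype.ext ?_⟩
      change Sum.elim (R (π₁ z)) (S (π₂ z)) = r
      rw [hz₁, hz₂, hx, hy, hr']
  exact ⟨(Continuous.homeoOfEquivCompactToT2 (f := Equiv.ofBijective Θ hΘ) hΘc).symm⟩

end PreAbstractSimplicialComplex

/-! ### Flagness, 4-cycles and suspensions of joins -/

namespace PreAbstractSimplicialComplex

section Combinatorics

variable {V : Type*} {W : Type*} {U : Type*}

/-- Two points lie on a common face. -/
def Nbr (K : PreAbstractSimplicialComplex V) (x y : V) : Prop :=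
  ∃ F ∈ K.faces, x ∈ F ∧ y ∈ F

theorem Nbr.symm {K : PreAbstractSimplicialComplex V} {x y : V} (h : K.Nbr x y) : K.Nbr y x :=
  let ⟨F, hF, hx, hy⟩ := h
  ⟨F, hF, hy, hx⟩

theorem nbr_iff [DecidableEq V] {K : PreAbstractSimplicialComplex V} {x y : V} :
    K.Nbr x y ↔ {x, y} ∈ K.faces := by
  constructor
  · rintro ⟨F, hF, hx, hy⟩
    exact mem_faces_of_subset hF (by simp [Finset.insert_subset_iff, hx, hy]) (by simp)
  · exact fun h => ⟨_, h, by simp, by simp⟩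

/-- Faces of a flag complex are the nonempty cliques: a minimal clique that is not a face would have
two elements, and would then be an edge. -/
theorem isFlag_iff {K : PreAbstractSimplicialComplex V} :
    K.IsFlag ↔ (∀ x, {x} ∈ K.faces) ∧
      ∀ F : Finset V, F.Nonempty → (∀ x ∈ F, ∀ y ∈ F, K.Nbr x y) → F ∈ K.faces := by
  classical
  constructor
  · intro h
    refine ⟨fun x => ?_, fun F => ?_⟩
    · by_contra hx
      have := h {x} (by simp) hx fun G hG hne => absurd (Finset.ssubset_singleton_iff.1 hG)
        hne.ne_empty
      simp at this
    · induction F using Finset.strongInduction with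
      | H F ih =>
        intro hne hF
        by_contra hFK
        obtain ⟨x, y, -, rfl⟩ := Finset.card_eq_two.1 (h F hne hFK fun G hG hGne =>
          ih G hG hGne fun x hx y hy => hF x (hG.1 hx) y (hG.1 hy))
        exact hFK (nbr_iff.1 (hF x (by simp) y (by simp)))
  · rintro ⟨h1, h2⟩ F hne hF hmin
    by_contra hcard
    refine hF (h2 F hne fun x hx y hy => ?_)
    by_cases hxy : x = y
    · subst hxy
      exact ⟨_, h1 x, by simp, by simp⟩
    · refine nbr_iff.2 (hmin _ (Finset.ssubset_iff_subset_ne.2 ⟨?_, ?_⟩) (by simp))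
      · simp [Finset.insert_subset_iff, hx, hy]
      · rintro rfl
        exact hcard (Finset.card_pair hxy)

theorem IsFlag.singleton_mem {K : PreAbstractSimplicialComplex V} (h : K.IsFlag) (x : V) :
    {x} ∈ K.faces :=
  (isFlag_iff.1 h).1 x

theorem IsFlag.mem_faces_iff {K : PreAbstractSimplicialComplex V} (h : K.IsFlag) {F : Finset V} :
    F ∈ K.faces ↔ F.Nonempty ∧ ∀ x ∈ F, ∀ y ∈ F, K.Nbr x y :=
  ⟨fun hF => ⟨nonempty_of_mem_faces hF, fun _ hx _ hy => ⟨F, hF, hx, hy⟩⟩,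
    fun hF => (isFlag_iff.1 h).2 F hF.1 hF.2⟩

theorem mem_join_iff {K : PreAbstractSimplicialComplex V} {L : PreAbstractSimplicialComplex W}
    {F : Finset (V ⊕ W)} : F ∈ (K.join L).faces ↔ F.Nonempty ∧
      (F.toLeft = ∅ ∨ F.toLeft ∈ K.faces) ∧ (F.toRight = ∅ ∨ F.toRight ∈ L.faces) :=
  Iff.rfl

theorem disjSum_mem_join_iff {K : PreAbstractSimplicialComplex V}
    {L : PreAbstractSimplicialComplex W} {F : Finset V} {G : Finset W} :
    F.disjSum G ∈ (K.join L).faces ↔ (F.disjSum G).Nonempty ∧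
      (F = ∅ ∨ F ∈ K.faces) ∧ (G = ∅ ∨ G ∈ L.faces) := by
  rw [mem_join_iff, Finset.toLeft_disjSum, Finset.toRight_disjSum]

theorem nbr_join_inl {K : PreAbstractSimplicialComplex V} {L : PreAbstractSimplicialComplex W}
    {x y : V} : (K.join L).Nbr (Sum.inl x) (Sum.inl y) ↔ K.Nbr x y := by
  constructor
  · rintro ⟨F, ⟨-, hF, -⟩, hx, hy⟩
    have hx' : x ∈ F.toLeft := by simpa using hx
    exact ⟨_, hF.resolve_left (Finset.ne_empty_of_mem hx'), hx', by simpa using hy⟩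
  · rintro ⟨F, hF, hx, hy⟩
    exact ⟨F.disjSum ∅, disjSum_mem_join_iff.2 ⟨⟨Sum.inl x, by simpa using hx⟩, Or.inr hF,
      Or.inl rfl⟩, by simpa using hx, by simpa using hy⟩

theorem nbr_join_inr {K : PreAbstractSimplicialComplex V} {L : PreAbstractSimplicialComplex W}
    {x y : W} : (K.join L).Nbr (Sum.inr x) (Sum.inr y) ↔ L.Nbr x y := by
  constructor
  · rintro ⟨F, ⟨-, -, hF⟩, hx, hy⟩
    have hx' : x ∈ F.toRight := by simpa using hx
    exact ⟨_, hF.resolve_left (Finset.ne_empty_of_mem hx'), hx', by simpa using hy⟩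
  · rintro ⟨F, hF, hx, hy⟩
    exact ⟨Finset.disjSum ∅ F, disjSum_mem_join_iff.2 ⟨⟨Sum.inr x, by simpa using hx⟩, Or.inl rfl,
      Or.inr hF⟩, by simpa using hx, by simpa using hy⟩

theorem nbr_join_inl_inr {K : PreAbstractSimplicialComplex V} {L : PreAbstractSimplicialComplex W}
    {x : V} {y : W} (hx : {x} ∈ K.faces) (hy : {y} ∈ L.faces) :
    (K.join L).Nbr (Sum.inl x) (Sum.inr y) :=
  ⟨Finset.disjSum {x} {y}, disjSum_mem_join_iff.2 ⟨⟨Sum.inl x, by simp⟩, Or.inr hx, Or.inr hy⟩,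
    by simp, by simp⟩

theorem IsFlag.join {K : PreAbstractSimplicialComplex V} {L : PreAbstractSimplicialComplex W}
    (hK : K.IsFlag) (hL : L.IsFlag) : (K.join L).IsFlag := by
  classical
  rw [isFlag_iff]
  constructor
  · rintro (x | y)
    · have := nbr_join_inl (L := L).2 (nbr_iff.2 (by simpa using hK.singleton_mem x) : K.Nbr x x)
      simpa using nbr_iff.1 this
    · have := nbr_join_inr (K := K).2 (nbr_iff.2 (by simpa using hL.singleton_mem y) : L.Nbr y y)
      simpa using nbr_iff.1 this
  · intro F hne hF
    refine ⟨hne, F.toLeft.eq_empty_or_nonempty.imp_right fun h => ?_,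
      F.toRight.eq_empty_or_nonempty.imp_right fun h => ?_⟩
    · exact hK.mem_faces_iff.2 ⟨h, fun x hx y hy => nbr_join_inl.1
        (hF _ (Finset.mem_toLeft.1 hx) _ (Finset.mem_toLeft.1 hy))⟩
    · exact hL.mem_faces_iff.2 ⟨h, fun x hx y hy => nbr_join_inr.1
        (hF _ (Finset.mem_toRight.1 hx) _ (Finset.mem_toRight.1 hy))⟩

theorem Isomorphic.symm {K : PreAbstractSimplicialComplex V} {L : PreAbstractSimplicialComplex W}
    (h : K.Isomorphic L) : L.Isomorphic K := by
  obtain ⟨e, he⟩ := h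
  refine ⟨e.symm, fun F => ?_⟩
  have h : (F.map e.symm.toEmbedding).map e.toEmbedding = F := by ext x; simp
  rw [he, h]

theorem Isomorphic.trans {K : PreAbstractSimplicialComplex V} {L : PreAbstractSimplicialComplex W}
    {M : PreAbstractSimplicialComplex U} (h : K.Isomorphic L) (h' : L.Isomorphic M) :
    K.Isomorphic M := by
  obtain ⟨e, he⟩ := h
  obtain ⟨e', he'⟩ := h'
  refine ⟨e.trans e', fun F => ?_⟩
  rw [he, he', Finset.map_map e.toEmbedding e'.toEmbedding F]
  rfl

theorem isomorphic_of_map {K : PreAbstractSimplicialComplex V}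
    {L : PreAbstractSimplicialComplex W} (i : V ↪ W)
    (h : ∀ F, F ∈ L.faces ↔ ∃ G ∈ K.faces, G.map i = F) : K.Isomorphic L := by
  have hmap (F : Finset V) : F.map i ∈ L.faces ↔ F ∈ K.faces := by
    rw [h]
    exact ⟨fun ⟨G, hG, hGF⟩ => Finset.map_injective i hGF ▸ hG, fun hF => ⟨F, hF, rfl⟩⟩
  refine ⟨Equiv.ofBijective
    (fun v => ⟨i v, (h _).2 ⟨{(v : V)}, v.2, Finset.map_singleton _ _⟩⟩) ⟨?_, ?_⟩, fun F => ?_⟩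
  · intro v w hvw
    exact Subtype.ext (i.injective (congrArg Subtype.val hvw))
  · rintro ⟨w, hw⟩
    obtain ⟨G, hG, hGw⟩ := (h _).1 hw
    obtain ⟨v, rfl⟩ := Finset.card_eq_one.1 (by rw [← Finset.card_map i, hGw, Finset.card_singleton])
    rw [Finset.map_singleton] at hGw
    exact ⟨⟨v, hG⟩, Subtype.ext (Finset.singleton_injective hGw)⟩
  · rw [← hmap, Finset.map_map, Finset.map_map]
    rfl

theorem nbr_iff_of_isomorphism {K : PreAbstractSimplicialComplex V}
    {L : PreAbstractSimplicialComplex W} {e : K.vertices ≃ L.vertices}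
    (he : ∀ F : Finset K.vertices, F.map (Function.Embedding.subtype _) ∈ K.faces ↔
      (F.map e.toEmbedding).map (Function.Embedding.subtype _) ∈ L.faces) (x y : K.vertices) :
    K.Nbr x y ↔ L.Nbr (e x) (e y) := by
  classical
  rw [nbr_iff, nbr_iff]
  simpa [Finset.map_insert] using he {x, y}

theorem not_nbr_fourCycle (j : Fin 4) : ¬ fourCycle.Nbr j (j + 2) := by
  rw [nbr_iff]
  rintro ⟨-, i, hi⟩
  revert i j
  decide

/-- The opposite vertex of the cycle works, since the cycle is induced. -/
theorem exists_not_nbr_of_isomorphic_fourCycle {K : PreAbstractSimplicialComplex V} {S : Set V}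
    (h : (K.induce S).Isomorphic fourCycle) {x : V} (hx : x ∈ (K.induce S).vertices) :
    ∃ y, ¬ K.Nbr x y := by
  classical
  obtain ⟨e, he⟩ := h
  have hvert (j : Fin 4) : j ∈ fourCycle.vertices := ⟨by simp, j, by simp⟩
  let y := e.symm ⟨(e ⟨x, hx⟩ : Fin 4) + 2, hvert _⟩
  refine ⟨y, fun hxy => ?_⟩
  have h1 : (K.induce S).Nbr x y := by
    rw [nbr_iff] at hxy ⊢
    refine ⟨hxy, fun z hz => ?_⟩
    have hz' : z = x ∨ z = y := by simpa using hz
    rcases hz' with rfl | rfl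
    · exact hx.2 (by simp)
    · exact y.2.2 (by simp)
  have h2 := (nbr_iff_of_isomorphism he ⟨x, hx⟩ y).1 h1
  rw [Equiv.apply_symm_apply] at h2
  exact not_nbr_fourCycle _ h2

theorem mem_fourCycle_iff (G : Finset (Fin 4)) :
    G ∈ fourCycle.faces ↔ G.Nonempty ∧ ∀ x ∈ G, ∀ y ∈ G, y ≠ x + 2 := by
  change (G.Nonempty ∧ ∃ i : Fin 4, G ⊆ {i, i + 1}) ↔ _
  revert G
  decide

theorem isomorphic_fourCycle_of_embedding {K : PreAbstractSimplicialComplex V} (hK : K.IsFlag)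
    (i : Fin 4 ↪ V) (hi : ∀ x y, K.Nbr (i x) (i y) ↔ y ≠ x + 2) :
    (K.induce (Set.range i)).Isomorphic fourCycle := by
  classical
  have hmap (G : Finset (Fin 4)) : G.map i ∈ K.faces ↔ G ∈ fourCycle.faces := by
    rw [hK.mem_faces_iff, mem_fourCycle_iff, Finset.map_nonempty]
    simp [hi]
  refine (isomorphic_of_map i fun F => ?_).symm
  constructor
  · rintro ⟨hF, hFi⟩
    have hG : (F.preimage i i.injective.injOn).map i = F := by
      ext x
      simp only [Finset.mem_map, Finset.mem_preimage]
      constructor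
      · rintro ⟨j, hj, rfl⟩
        exact hj
      · intro hx
        obtain ⟨j, rfl⟩ := hFi hx
        exact ⟨j, hx, rfl⟩
    exact ⟨_, (hmap _).1 (hG.symm ▸ hF), hG⟩
  · rintro ⟨G, hG, rfl⟩
    refine ⟨(hmap G).2 hG, fun x hx => ?_⟩
    obtain ⟨j, -, rfl⟩ := Finset.mem_map.1 (Finset.mem_coe.1 hx)
    exact ⟨j, rfl⟩

theorem mem_induce_inl_iff {K : PreAbstractSimplicialComplex V}
    {L : PreAbstractSimplicialComplex W} {S : Set V} (F : Finset (V ⊕ W)) :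
    F ∈ ((K.join L).induce (Sum.inl '' S)).faces ↔
      ∃ G ∈ (K.induce S).faces, G.map Function.Embedding.inl = F := by
  constructor
  · rintro ⟨⟨hne, hK, -⟩, hS⟩
    have hF : F.toLeft.map Function.Embedding.inl = F := by
      ext x
      rcases x with v | w
      · simp
      · simp only [Finset.mem_map, Function.Embedding.inl_apply, reduceCtorEq, and_false,
          exists_false, false_iff]
        intro h
        obtain ⟨v, -, hv⟩ := hS h
        exact Sum.inl_ne_inr hv
    refine ⟨F.toLeft, ⟨hK.resolve_left fun h => ?_, fun v hv => ?_⟩, hF⟩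
    · rw [h, Finset.map_empty] at hF
      exact hne.ne_empty hF.symm
    · obtain ⟨v', hv', h⟩ := hS (Finset.mem_toLeft.1 hv)
      exact Sum.inl_injective h ▸ hv'
  · rintro ⟨G, ⟨hG, hS⟩, rfl⟩
    have hne := nonempty_of_mem_faces hG
    rw [← Finset.disjSum_empty]
    refine ⟨disjSum_mem_join_iff.2 ⟨by simpa using hne, Or.inr hG, Or.inl rfl⟩, ?_⟩
    rintro (v | w) hx
    · exact ⟨v, hS (by simpa using hx), rfl⟩
    · simp at hx

theorem mem_induce_inr_iff {K : PreAbstractSimplicialComplex V}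
    {L : PreAbstractSimplicialComplex W} {S : Set W} (F : Finset (V ⊕ W)) :
    F ∈ ((K.join L).induce (Sum.inr '' S)).faces ↔
      ∃ G ∈ (L.induce S).faces, G.map Function.Embedding.inr = F := by
  constructor
  · rintro ⟨⟨hne, -, hL⟩, hS⟩
    have hF : F.toRight.map Function.Embedding.inr = F := by
      ext x
      rcases x with v | w
      · simp only [Finset.mem_map, Function.Embedding.inr_apply, reduceCtorEq, and_false,
          exists_false, false_iff]
        intro h
        obtain ⟨w, -, hw⟩ := hS h
        exact Sum.inr_ne_inl hw
      · simp
    refine ⟨F.toRight, ⟨hL.resolve_left fun h => ?_, fun w hw => ?_⟩, hF⟩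
    · rw [h, Finset.map_empty] at hF
      exact hne.ne_empty hF.symm
    · obtain ⟨w', hw', h⟩ := hS (Finset.mem_toRight.1 hw)
      exact Sum.inr_injective h ▸ hw'
  · rintro ⟨G, ⟨hG, hS⟩, rfl⟩
    have hne := nonempty_of_mem_faces hG
    rw [← Finset.empty_disjSum]
    refine ⟨disjSum_mem_join_iff.2 ⟨by simpa using hne, Or.inl rfl, Or.inr hG⟩, ?_⟩
    rintro (v | w) hx
    · simp at hx
    · exact ⟨w, hS (by simpa using hx), rfl⟩

theorem not_isContractibleEdge_join {K : PreAbstractSimplicialComplex V}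
    {L : PreAbstractSimplicialComplex W} (hK : K.IsFlag) (hL : L.IsFlag)
    (hK' : ∀ F, ¬ K.IsContractibleEdge F) (hL' : ∀ F, ¬ L.IsContractibleEdge F)
    (hKn : ∀ x, ∃ y, ¬ K.Nbr x y) (hLn : ∀ x, ∃ y, ¬ L.Nbr x y) (F : Finset (V ⊕ W)) :
    ¬ (K.join L).IsContractibleEdge F := by
  rintro ⟨hF, hcard, hS⟩
  obtain ⟨A, B, rfl⟩ : ∃ A B, F = Finset.disjSum A B :=
    ⟨_, _, Finset.toLeft_disjSum_toRight.symm⟩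
  obtain ⟨-, hA, hB⟩ := disjSum_mem_join_iff.1 hF
  rw [Finset.card_disjSum] at hcard
  rcases A.eq_empty_or_nonempty with rfl | hAne
  · rw [Finset.card_empty, zero_add] at hcard
    have hB' := hB.resolve_left (by rintro rfl; simp at hcard)
    obtain ⟨S, hBS, hiso⟩ := not_not.1 fun h => hL' B ⟨hB', hcard, h⟩
    refine hS ⟨Sum.inr '' S, ?_, (isomorphic_of_map _ mem_induce_inr_iff).symm.trans hiso⟩
    exact (mem_induce_inr_iff _).2 ⟨B, hBS, (Finset.empty_disjSum _).symm⟩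
  rcases B.eq_empty_or_nonempty with rfl | hBne
  · rw [Finset.card_empty, add_zero] at hcard
    have hA' := hA.resolve_left (by rintro rfl; simp at hcard)
    obtain ⟨S, hAS, hiso⟩ := not_not.1 fun h => hK' A ⟨hA', hcard, h⟩
    refine hS ⟨Sum.inl '' S, ?_, (isomorphic_of_map _ mem_induce_inl_iff).symm.trans hiso⟩
    exact (mem_induce_inl_iff _).2 ⟨A, hAS, (Finset.disjSum_empty _).symm⟩
  -- A mixed edge `xy`: non-neighbours `x'` and `y'` complete it to the induced square `x, y, x',
  -- y'`.
  · have hA1 := hAne.card_pos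
    have hB1 := hBne.card_pos
    obtain ⟨x, rfl⟩ := Finset.card_eq_one.1 (show A.card = 1 by omega)
    obtain ⟨y, rfl⟩ := Finset.card_eq_one.1 (show B.card = 1 by omega)
    obtain ⟨x', hx'⟩ := hKn x
    obtain ⟨y', hy'⟩ := hLn y
    have hxx (z : V) : K.Nbr z z := ⟨_, hK.singleton_mem z, by simp, by simp⟩
    have hyy (z : W) : L.Nbr z z := ⟨_, hL.singleton_mem z, by simp, by simp⟩
    have hxy (z : V) (w : W) : (K.join L).Nbr (Sum.inl z) (Sum.inr w) :=
      nbr_join_inl_inr (hK.singleton_mem z) (hL.singleton_mem w)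
    have hyx (z : V) (w : W) : (K.join L).Nbr (Sum.inr w) (Sum.inl z) := (hxy z w).symm
    have hx'' : ¬ K.Nbr x' x := fun h => hx' h.symm
    have hy'' : ¬ L.Nbr y' y := fun h => hy' h.symm
    have hxne : x ≠ x' := by rintro rfl; exact hx' (hxx x)
    have hyne : y ≠ y' := by rintro rfl; exact hy' (hyy y)
    let i : Fin 4 → V ⊕ W := ![Sum.inl x, Sum.inr y, Sum.inl x', Sum.inr y']
    have hi : Function.Injective i := by
      intro a b
      fin_cases a <;> fin_cases b <;> simp [i, hxne, hyne, hxne.symm, hyne.symm]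
    refine hS ⟨Set.range i, ⟨hF, ?_⟩,
      isomorphic_fourCycle_of_embedding (hK.join hL) ⟨i, hi⟩ fun a b => ?_⟩
    · rintro (z | z) hz
      · have : z = x := by simpa using hz
        exact ⟨0, by simp [i, this]⟩
      · have : z = y := by simpa using hz
        exact ⟨1, by simp [i, this]⟩
    · fin_cases a <;> fin_cases b <;>
        simp [i, nbr_join_inl, nbr_join_inr, hxx, hyy, hxy, hyx, hx', hy', hx'', hy'']

theorem IsSuspension.exists_poles {K : PreAbstractSimplicialComplex V} (h : K.IsSuspension) :
    ∃ a b, a ≠ b ∧ ¬ K.Nbr a b ∧ ∀ c ∈ K.vertices, c ≠ a → c ≠ b → K.Nbr a c ∧ K.Nbr b c := by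
  obtain ⟨U, L, e, he⟩ := h
  have hpole (j : Fin 2) : Sum.inr j ∈ (L.join twoPoints).vertices := by
    have : {Sum.inr j} = Finset.disjSum (∅ : Finset U) {j} := by ext x; cases x <;> simp
    change {Sum.inr j} ∈ (L.join twoPoints).faces
    rw [this]
    exact disjSum_mem_join_iff.2 ⟨⟨Sum.inr j, by simp⟩, Or.inl rfl, Or.inr (Finset.card_singleton j)⟩
  have h01 : (⟨Sum.inr 0, hpole 0⟩ : (L.join twoPoints).vertices) ≠ ⟨Sum.inr 1, hpole 1⟩ := by
    simp
  refine ⟨e.symm ⟨_, hpole 0⟩, e.symm ⟨_, hpole 1⟩, fun h => ?_, fun h => ?_, fun c hc hca hcb => ?_⟩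
  · exact h01 (e.symm.injective (Subtype.ext h))
  · rw [nbr_iff_of_isomorphism he, Equiv.apply_symm_apply, Equiv.apply_symm_apply, nbr_join_inr] at h
    obtain ⟨F, hF, h0, h1⟩ := h
    exact zero_ne_one (Finset.card_le_one.1 (le_of_eq hF) 0 h0 1 h1)
  · obtain ⟨z, hz⟩ : ∃ z, e ⟨c, hc⟩ = z := ⟨_, rfl⟩
    have hc' : c = e.symm z := by rw [← hz, Equiv.symm_apply_apply]
    obtain ⟨u | j, hu⟩ := z
    · have hu' : {u} ∈ L.faces := by
        obtain ⟨-, h, -⟩ := hu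
        have hu1 : ({Sum.inl u} : Finset (U ⊕ Fin 2)).toLeft = {u} := by ext; simp
        rw [hu1] at h
        exact h.resolve_left (Finset.singleton_ne_empty u)
      have hj (j : Fin 2) : K.Nbr (e.symm ⟨_, hpole j⟩) c := by
        rw [hc', nbr_iff_of_isomorphism he, Equiv.apply_symm_apply, Equiv.apply_symm_apply]
        exact (nbr_join_inl_inr hu' (Finset.card_singleton j)).symm
      exact ⟨hj 0, hj 1⟩
    · fin_cases j
      · exact absurd hc' hca
      · exact absurd hc' hcb

/-- The converse of `IsSuspension.exists_poles` for flag complexes: faces are cliques, so `K` is the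
join of the poles with the subcomplex induced on all other points. -/
theorem IsFlag.isSuspension_of_poles {K : PreAbstractSimplicialComplex V} (hK : K.IsFlag)
    {a b : V} (hne : a ≠ b) (hab : ¬ K.Nbr a b)
    (h : ∀ c, c ≠ a → c ≠ b → K.Nbr a c ∧ K.Nbr b c) : K.IsSuspension := by
  classical
  let f : V → V ⊕ Fin 2 := fun v =>
    if v = a then Sum.inr 0 else if v = b then Sum.inr 1 else Sum.inl v
  have hfa : f a = Sum.inr 0 := if_pos rfl
  have hfb : f b = Sum.inr 1 := (if_neg hne.symm).trans (if_pos rfl)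
  have hfv {v : V} (hva : v ≠ a) (hvb : v ≠ b) : f v = Sum.inl v :=
    (if_neg hva).trans (if_neg hvb)
  have hcases (v : V) : v = a ∨ v = b ∨ (v ≠ a ∧ v ≠ b) := by tauto
  have hf : Function.Injective f := by
    intro v w hvw
    rcases hcases v with rfl | rfl | ⟨h1, h2⟩ <;> rcases hcases w with rfl | rfl | ⟨h3, h4⟩ <;>
      simp_all
  refine ⟨V, K.induce {a, b}ᶜ, isomorphic_of_map ⟨f, hf⟩ fun F => ⟨?_, ?_⟩⟩
  · rintro ⟨hFne, hFl, hFr⟩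
    have hleft {v : V} (hv : Sum.inl v ∈ F) : F.toLeft ∈ K.faces ∧ v ≠ a ∧ v ≠ b := by
      have hv' : v ∈ F.toLeft := Finset.mem_toLeft.2 hv
      obtain ⟨h1, h2⟩ := hFl.resolve_left (Finset.ne_empty_of_mem hv')
      have h3 := h2 hv'
      simp only [Set.mem_compl_iff, Set.mem_insert_iff, Set.mem_singleton_iff, not_or] at h3
      exact ⟨h1, h3⟩
    have hright (h0 : Sum.inr 0 ∈ F) (h1 : Sum.inr 1 ∈ F) : False := by
      have h0' : 0 ∈ F.toRight := Finset.mem_toRight.2 h0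
      have hc : F.toRight.card = 1 := hFr.resolve_left (Finset.ne_empty_of_mem h0')
      exact zero_ne_one (Finset.card_le_one.1 hc.le 0 h0' 1 (Finset.mem_toRight.2 h1))
    have hG : (F.preimage f hf.injOn).map ⟨f, hf⟩ = F := by
      ext x
      simp only [Finset.mem_map, Finset.mem_preimage, Function.Embedding.coeFn_mk]
      constructor
      · rintro ⟨v, hv, rfl⟩
        exact hv
      · intro hx
        rcases x with v | j
        · have := hfv (hleft hx).2.1 (hleft hx).2.2
          exact ⟨v, this.symm ▸ hx, this⟩
        · fin_cases j
          · exact ⟨a, hfa.symm ▸ hx, hfa⟩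
          · exact ⟨b, hfb.symm ▸ hx, hfb⟩
    refine ⟨_, hK.mem_faces_iff.2 ⟨?_, fun v hv w hw => ?_⟩, hG⟩
    · rw [← Finset.map_nonempty (f := ⟨f, hf⟩), hG]
      exact hFne
    · rw [Finset.mem_preimage] at hv hw
      have hself (v : V) : K.Nbr v v := ⟨_, hK.singleton_mem v, by simp, by simp⟩
      rcases hcases v with rfl | rfl | ⟨h1, h2⟩ <;> rcases hcases w with rfl | rfl | ⟨h3, h4⟩
      · exact hself _
      · exact (hright (hfa ▸ hv) (hfb ▸ hw)).elim
      · exact (h w h3 h4).1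
      · exact (hright (hfa ▸ hw) (hfb ▸ hv)).elim
      · exact hself _
      · exact (h w h3 h4).2
      · exact (h v h1 h2).1.symm
      · exact (h v h1 h2).2.symm
      · rw [hfv h1 h2] at hv
        rw [hfv h3 h4] at hw
        exact ⟨_, (hleft hv).1, Finset.mem_toLeft.2 hv, Finset.mem_toLeft.2 hw⟩
  · rintro ⟨G, hG, rfl⟩
    have hmem {v : V} : Sum.inl v ∈ G.map ⟨f, hf⟩ → v ∈ G ∧ v ≠ a ∧ v ≠ b := by
      rw [Finset.mem_map]
      rintro ⟨w, hw, hwv⟩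
      rcases hcases w with rfl | rfl | ⟨h1, h2⟩
      · exact absurd (hfa.symm.trans hwv) Sum.inr_ne_inl
      · exact absurd (hfb.symm.trans hwv) Sum.inr_ne_inl
      · obtain rfl : w = v := Sum.inl_injective ((hfv h1 h2).symm.trans hwv)
        exact ⟨hw, h1, h2⟩
    refine ⟨(nonempty_of_mem_faces hG).map, (Finset.eq_empty_or_nonempty _).imp_right fun hl => ?_,
      (Finset.eq_empty_or_nonempty _).imp_right fun hr => ?_⟩
    · refine ⟨mem_faces_of_subset hG (fun v hv => (hmem (Finset.mem_toLeft.1 hv)).1) hl,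
        fun v hv => ?_⟩
      have := (hmem (Finset.mem_toLeft.1 hv)).2
      simpa using this
    · have ha : Sum.inr 0 ∈ G.map ⟨f, hf⟩ → a ∈ G := fun h => by
        rw [← hfa] at h
        exact (Finset.mem_map' ⟨f, hf⟩).1 h
      have hb : Sum.inr 1 ∈ G.map ⟨f, hf⟩ → b ∈ G := fun h => by
        rw [← hfb] at h
        exact (Finset.mem_map' ⟨f, hf⟩).1 h
      refine le_antisymm (Finset.card_le_one.2 fun i hi j hj => ?_) hr.card_pos
      rw [Finset.mem_toRight] at hi hj
      by_contra hij
      fin_cases i <;> fin_cases j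
      · exact hij rfl
      · exact hab ⟨G, hG, ha hi, hb hj⟩
      · exact hab ⟨G, hG, ha hj, hb hi⟩
      · exact hij rfl

/-- Points of different factors are adjacent, so the two poles lie in the same factor, and they are
poles of it. -/
theorem isSuspension_of_join {K : PreAbstractSimplicialComplex V}
    {L : PreAbstractSimplicialComplex W} (hK : K.IsFlag) (hL : L.IsFlag)
    (h : (K.join L).IsSuspension) : K.IsSuspension ∨ L.IsSuspension := by
  have hv := (hK.join hL).singleton_mem
  obtain ⟨a | a, b | b, hne, hab, hc⟩ := h.exists_poles
  · refine Or.inl (hK.isSuspension_of_poles (a := a) (b := b) (fun h => hne (congrArg _ h))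
      (fun h => hab (nbr_join_inl.2 h)) fun c h1 h2 => ?_)
    have := hc (Sum.inl c) (hv _) (fun h => h1 (Sum.inl_injective h))
      (fun h => h2 (Sum.inl_injective h))
    rwa [nbr_join_inl, nbr_join_inl] at this
  · exact absurd (nbr_join_inl_inr (hK.singleton_mem a) (hL.singleton_mem b)) hab
  · exact absurd (nbr_join_inl_inr (hK.singleton_mem b) (hL.singleton_mem a)).symm hab
  · refine Or.inr (hL.isSuspension_of_poles (a := a) (b := b) (fun h => hne (congrArg _ h))
      (fun h => hab (nbr_join_inr.2 h)) fun c h1 h2 => ?_)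
    have := hc (Sum.inr c) (hv _) (fun h => h1 (Sum.inr_injective h))
      (fun h => h2 (Sum.inr_injective h))
    rwa [nbr_join_inr, nbr_join_inr] at this

end Combinatorics

end PreAbstractSimplicialComplex

/-! ### Links and induced subcomplexes of joins -/

namespace PreAbstractSimplicialComplex

section Links

variable {V : Type*} {W : Type*}

theorem mem_link_iff [DecidableEq V] {K : PreAbstractSimplicialComplex V} {F G : Finset V} :
    G ∈ (K.link F).faces ↔ G ∈ K.faces ∧ Disjoint F G ∧ F ∪ G ∈ K.faces := by
  change (G ∈ K.faces ∧ ∃ h : Disjoint F G, F.disjUnion G h ∈ K.faces) ↔ _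
  simp only [Finset.disjUnion_eq_union, exists_prop]

theorem link_empty (K : PreAbstractSimplicialComplex V) : K.link ∅ = K := by
  classical
  refine PreAbstractSimplicialComplex.ext (Set.ext fun G => ?_)
  rw [mem_link_iff]
  simp

/-- Either part may be the empty face, so that links of faces of a single factor are covered. -/
theorem link_join {K : PreAbstractSimplicialComplex V} {L : PreAbstractSimplicialComplex W}
    {F : Finset V} {G : Finset W} (hF : F = ∅ ∨ F ∈ K.faces) (hG : G = ∅ ∨ G ∈ L.faces) :
    (K.join L).link (F.disjSum G) = (K.link F).join (L.link G) := by
  classical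
  refine PreAbstractSimplicialComplex.ext (Set.ext fun H => ?_)
  obtain ⟨A, B, rfl⟩ : ∃ A B, H = Finset.disjSum A B :=
    ⟨_, _, Finset.toLeft_disjSum_toRight.symm⟩
  have hunion : F.disjSum G ∪ A.disjSum B = (F ∪ A).disjSum (G ∪ B) := by
    ext x
    cases x <;> simp
  have hdisj : Disjoint (F.disjSum G) (A.disjSum B) ↔ Disjoint F A ∧ Disjoint G B := by
    simp [Finset.disjoint_left]
  rw [mem_link_iff, hunion, hdisj, disjSum_mem_join_iff, disjSum_mem_join_iff, disjSum_mem_join_iff,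
    mem_link_iff, mem_link_iff]
  constructor
  · rintro ⟨⟨hne, hA, hB⟩, ⟨hFA, hGB⟩, -, hFA', hGB'⟩
    refine ⟨hne, A.eq_empty_or_nonempty.imp_right fun h => ?_,
      B.eq_empty_or_nonempty.imp_right fun h => ?_⟩
    · exact ⟨hA.resolve_left h.ne_empty, hFA, hFA'.resolve_left (h.inr).ne_empty⟩
    · exact ⟨hB.resolve_left h.ne_empty, hGB, hGB'.resolve_left (h.inr).ne_empty⟩
  · rintro ⟨hne, hA, hB⟩
    refine ⟨⟨hne, hA.imp_right And.left, hB.imp_right And.left⟩, ⟨?_, ?_⟩, ?_, ?_, ?_⟩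
    · rcases hA with rfl | hA
      · exact Finset.disjoint_empty_right F
      · exact hA.2.1
    · rcases hB with rfl | hB
      · exact Finset.disjoint_empty_right G
      · exact hB.2.1
    · obtain ⟨x, hx⟩ := hne
      refine ⟨x, ?_⟩
      rw [← hunion]
      exact Finset.mem_union_right _ hx
    · rcases hA with rfl | hA
      · rwa [Finset.union_empty]
      · exact Or.inr hA.2.2
    · rcases hB with rfl | hB
      · rwa [Finset.union_empty]
      · exact Or.inr hB.2.2

theorem induce_join (K : PreAbstractSimplicialComplex V) (L : PreAbstractSimplicialComplex W)
    (S : Set (V ⊕ W)) :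
    (K.join L).induce S = (K.induce (Sum.inl ⁻¹' S)).join (L.induce (Sum.inr ⁻¹' S)) := by
  refine PreAbstractSimplicialComplex.ext (Set.ext fun H => ?_)
  constructor
  · rintro ⟨⟨hne, hK, hL⟩, hS⟩
    exact ⟨hne, hK.imp_right fun h => ⟨h, fun v hv => hS (Finset.mem_toLeft.1 hv)⟩,
      hL.imp_right fun h => ⟨h, fun w hw => hS (Finset.mem_toRight.1 hw)⟩⟩
  · rintro ⟨hne, hK, hL⟩
    refine ⟨⟨hne, hK.imp_right And.left, hL.imp_right And.left⟩, ?_⟩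
    rintro (v | w) h
    · have h' : v ∈ H.toLeft := Finset.mem_toLeft.2 h
      exact (hK.resolve_left (Finset.ne_empty_of_mem h')).2 h'
    · have h' : w ∈ H.toRight := Finset.mem_toRight.2 h
      exact (hL.resolve_left (Finset.ne_empty_of_mem h')).2 h'

/-- A face of maximal cardinality works, with `∅` for a complex without nonempty faces. -/
theorem exists_link_faces_eq_empty [Finite V] (K : PreAbstractSimplicialComplex V) :
    ∃ F, (F = ∅ ∨ F ∈ K.faces) ∧ (K.link F).faces = ∅ := by
  classical
  have hfin : {F : Finset V | F = ∅ ∨ F ∈ K.faces}.Finite := Set.toFinite _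
  obtain ⟨F, hF, hmax⟩ := hfin.exists_maximalFor Finset.card _ ⟨∅, Or.inl rfl⟩
  refine ⟨F, hF, Set.eq_empty_of_forall_notMem fun G hG => ?_⟩
  rw [mem_link_iff] at hG
  have h1 := hmax (Or.inr hG.2.2) (Finset.card_le_card Finset.subset_union_left)
  rw [Finset.card_union_of_disjoint hG.2.1] at h1
  have := (nonempty_of_mem_faces hG.1).card_pos
  omega

theorem induce_faces_subset (K : PreAbstractSimplicialComplex V) (S : Set V) :
    (K.induce S).faces ⊆ K.faces :=
  fun _ h => h.1

end Links

/-! ### Induced equators of joins -/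

section Equators

variable {V : Type*} {W : Type*} [Fintype V] [Fintype W]

theorem isSphereIn_join_iff_right {K : PreAbstractSimplicialComplex V} (hK : K.faces = ∅)
    (L : PreAbstractSimplicialComplex W) (k : ℕ) : (K.join L).IsSphereIn k ↔ L.IsSphereIn k := by
  refine isSphereIn_iff_of_map Function.Embedding.inr (fun F => ?_) k
  obtain ⟨A, B, rfl⟩ : ∃ A B, F = Finset.disjSum A B :=
    ⟨_, _, Finset.toLeft_disjSum_toRight.symm⟩
  rw [disjSum_mem_join_iff, hK]
  constructor
  · rintro ⟨hne, rfl | hA, hB⟩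
    · exact ⟨B, hB.resolve_left (by rintro rfl; simp at hne), (Finset.empty_disjSum B).symm⟩
    · exact hA.elim
  · rintro ⟨G, hG, hGF⟩
    rw [← Finset.empty_disjSum] at hGF
    rw [← hGF]
    obtain ⟨rfl, rfl⟩ := Finset.disjSum_inj.1 hGF
    have hne := nonempty_of_mem_faces hG
    exact ⟨by simpa using hne, Or.inl rfl, Or.inr hG⟩

theorem isSphereIn_join_iff_left {L : PreAbstractSimplicialComplex W} (hL : L.faces = ∅)
    (K : PreAbstractSimplicialComplex V) (k : ℕ) : (K.join L).IsSphereIn k ↔ K.IsSphereIn k := by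
  refine isSphereIn_iff_of_map Function.Embedding.inl (fun F => ?_) k
  obtain ⟨A, B, rfl⟩ : ∃ A B, F = Finset.disjSum A B :=
    ⟨_, _, Finset.toLeft_disjSum_toRight.symm⟩
  rw [disjSum_mem_join_iff, hL]
  constructor
  · rintro ⟨hne, hA, rfl | hB⟩
    · exact ⟨A, hA.resolve_left (by rintro rfl; simp at hne), (Finset.disjSum_empty A).symm⟩
    · exact hB.elim
  · rintro ⟨G, hG, hGF⟩
    rw [← Finset.disjSum_empty] at hGF
    rw [← hGF]
    obtain ⟨rfl, rfl⟩ := Finset.disjSum_inj.1 hGF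
    have hne := nonempty_of_mem_faces hG
    exact ⟨by simpa using hne, Or.inr hG, Or.inl rfl⟩

/-- If a join is a sphere all of whose links are spheres, then so are the two factors. -/
theorem factors_of_isSphereIn_join {k : ℕ} {K : PreAbstractSimplicialComplex V}
    {L : PreAbstractSimplicialComplex W} (h : (K.join L).IsSphereIn k)
    (h' : (K.join L).HasSphericalLinks k) :
    ∃ a b, a + b = k ∧ K.IsSphereIn a ∧ L.IsSphereIn b ∧
      K.HasSphericalLinks a ∧ L.HasSphericalLinks b := by
  have hall {F : Finset V} {G : Finset W} (hF : F = ∅ ∨ F ∈ K.faces) (hG : G = ∅ ∨ G ∈ L.faces) :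
      ∃ j, j + (F.card + G.card) = k ∧ ((K.link F).join (L.link G)).IsSphereIn j := by
    rw [← link_join hF hG, ← Finset.card_disjSum]
    -- `HasSphericalLinks` only speaks of nonempty faces; for the empty face the link is the sphere
    -- itself.
    rcases (F.disjSum G).eq_empty_or_nonempty with hne | hne
    · rw [hne, link_empty]
      exact ⟨k, rfl, h⟩
    · obtain ⟨j, hj, hj'⟩ := h' _ (disjSum_mem_join_iff.2 ⟨hne, hF, hG⟩)
      exact ⟨j, hj, hj'⟩
  obtain ⟨F, hF, hF0⟩ := K.exists_link_faces_eq_empty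
  obtain ⟨G, hG, hG0⟩ := L.exists_link_faces_eq_empty
  -- The link of the facet `F ⊔ G` is empty, so it is the sphere in dimension `j = 0`.
  have hk : F.card + G.card = k := by
    obtain ⟨j, hj, hj'⟩ := hall hF hG
    rw [isSphereIn_join_iff_right hF0] at hj'
    have := hj'.eq_zero hG0
    omega
  -- The link of `A ⊔ G` is the link of `A` joined with an empty complex. The case `A = ∅` gives `K`
  -- itself.
  have hK {A : Finset V} (hA : A = ∅ ∨ A ∈ K.faces) :
      ∃ j, j + A.card = F.card ∧ (K.link A).IsSphereIn j := by
    obtain ⟨j, hj, hj'⟩ := hall hA hG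
    exact ⟨j, by omega, (isSphereIn_join_iff_left hG0 _ _).1 hj'⟩
  have hL {B : Finset W} (hB : B = ∅ ∨ B ∈ L.faces) :
      ∃ j, j + B.card = G.card ∧ (L.link B).IsSphereIn j := by
    obtain ⟨j, hj, hj'⟩ := hall hF hB
    exact ⟨j, by omega, (isSphereIn_join_iff_right hF0 _ _).1 hj'⟩
  refine ⟨F.card, G.card, hk, ?_, ?_, fun A hA => hK (Or.inr hA), fun B hB => hL (Or.inr hB)⟩
  · obtain ⟨j, rfl, hj⟩ := hK (Or.inl rfl)
    rwa [link_empty] at hj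
  · obtain ⟨j, rfl, hj⟩ := hL (Or.inl rfl)
    rwa [link_empty] at hj

theorem isVertexLink_of_isInducedEquator_join {m n : ℕ} {K : PreAbstractSimplicialComplex V}
    {L : PreAbstractSimplicialComplex W} (hK : K.IsSimplicialSphere m)
    (hL : L.IsSimplicialSphere n) (hK' : ∀ E, K.IsInducedEquator m E → K.IsVertexLink E)
    (hL' : ∀ E, L.IsInducedEquator n E → L.IsVertexLink E)
    {E : PreAbstractSimplicialComplex (V ⊕ W)}
    (hE : (K.join L).IsInducedEquator (n + m + 1) E) : (K.join L).IsVertexLink E := by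
  obtain ⟨⟨S, rfl⟩, hsphere, hlinks⟩ := hE
  rw [induce_join] at hsphere hlinks ⊢
  obtain ⟨a, b, hab, hKa, hLb, hKl, hLl⟩ := factors_of_isSphereIn_join hsphere hlinks
  have ha : a ≤ m + 1 := hKa.le_of_faces_subset hK (K.induce_faces_subset _)
  have hb : b ≤ n + 1 := hLb.le_of_faces_subset hL (L.induce_faces_subset _)
  -- Since `a + b = n + m + 1` is one less than the sum of the upper bounds, exactly one bound is
  -- attained, and the other is missed by one.
  obtain ⟨rfl, rfl⟩ | ⟨rfl, rfl⟩ : (a = m + 1 ∧ b = n) ∨ (a = m ∧ b = n + 1) := by omega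
  · obtain ⟨y, hy, hEy⟩ := hL' _ ⟨⟨_, rfl⟩, hLb, hLl⟩
    have hyF : Finset.disjSum (∅ : Finset V) {y} = {Sum.inr y} := by ext x; cases x <;> simp
    refine ⟨Sum.inr y, ?_, ?_⟩
    · change {Sum.inr y} ∈ (K.join L).faces
      rw [← hyF]
      exact disjSum_mem_join_iff.2 ⟨by simp, Or.inl rfl, Or.inr hy⟩
    · rw [← hyF, link_join (Or.inl rfl) (Or.inr hy), link_empty, hEy,
        hKa.eq_of_faces_subset hK (K.induce_faces_subset _)]
  · obtain ⟨x, hx, hEx⟩ := hK' _ ⟨⟨_, rfl⟩, hKa, hKl⟩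
    have hxF : Finset.disjSum {x} (∅ : Finset W) = {Sum.inl x} := by ext x; cases x <;> simp
    refine ⟨Sum.inl x, ?_, ?_⟩
    · change {Sum.inl x} ∈ (K.join L).faces
      rw [← hxF]
      exact disjSum_mem_join_iff.2 ⟨by simp, Or.inr hx, Or.inl rfl⟩
    · rw [← hxF, link_join (Or.inr hx) (Or.inl rfl), link_empty, hEx,
        hLb.eq_of_faces_subset hL (L.induce_faces_subset _)]

/-- A sphere in `ℝ^(m + 1)` has two antipodal points, while a realization on one vertex has at most
one point. -/
theorem IsSimplicialSphere.exists_ne {m : ℕ} {K : PreAbstractSimplicialComplex V}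
    (hK : K.IsSimplicialSphere m) (x : V) : ∃ y, y ≠ x := by
  by_contra! h
  have : Subsingleton V := ⟨fun y z => (h y).trans (h z).symm⟩
  obtain ⟨φ⟩ := hK
  let e : Metric.sphere (0 : EuclideanSpace ℝ (Fin (m + 1))) 1 :=
    ⟨EuclideanSpace.single 0 1, by simp⟩
  refine sphere_neg_ne e (φ.symm.injective (Subtype.ext (funext fun y => ?_)))
  have h1 := (φ.symm e).2.1.2
  have h2 := (φ.symm (-e)).2.1.2
  rw [Fintype.sum_subsingleton _ y] at h1 h2
  exact h2.trans h1.symm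

/-- Any other point `y` is either not adjacent to `x`, or the edge `xy` lies in an induced 4-cycle,
where `x` has an opposite vertex. -/
theorem IsSimplicialSphere.exists_not_nbr {m : ℕ} {K : PreAbstractSimplicialComplex V}
    (hK : K.IsSimplicialSphere m) (hedge : ∀ F, ¬ K.IsContractibleEdge F)
    (x : V) : ∃ y, ¬ K.Nbr x y := by
  classical
  obtain ⟨y, hy⟩ := hK.exists_ne x
  by_cases hxy : K.Nbr x y
  · obtain ⟨S, hS, hiso⟩ := not_not.1 fun h =>
      hedge {x, y} ⟨nbr_iff.1 hxy, Finset.card_pair hy.symm, h⟩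
    exact exists_not_nbr_of_isomorphic_fourCycle hiso
      (mem_faces_of_subset hS (by simp) (Finset.singleton_nonempty x))
  · exact ⟨y, hxy⟩

end Equators

end PreAbstractSimplicialComplex

theorem mainTheorem4 {V₁ : Type u} {V₂ : Type v} [Fintype V₁] [Fintype V₂] (m n : ℕ)
    (Φ₁ : PreAbstractSimplicialComplex V₁) (Φ₂ : PreAbstractSimplicialComplex V₂)
    (hflag₁ : Φ₁.IsFlag) (hsphere₁ : Φ₁.IsSimplicialSphere m)
    (hflag₂ : Φ₂.IsFlag) (hsphere₂ : Φ₂.IsSimplicialSphere n)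
    (hedge₁ : ∀ F, ¬ Φ₁.IsContractibleEdge F) (hsusp₁ : ¬ Φ₁.IsSuspension)
    (hedge₂ : ∀ F, ¬ Φ₂.IsContractibleEdge F) (hsusp₂ : ¬ Φ₂.IsSuspension)
    (heq₁ : ∀ E, Φ₁.IsInducedEquator m E → Φ₁.IsVertexLink E)
    (heq₂ : ∀ E, Φ₂.IsInducedEquator n E → Φ₂.IsVertexLink E) :
    (Φ₁.join Φ₂).IsFlag ∧
    (Φ₁.join Φ₂).IsSimplicialSphere (n + m + 1) ∧
    (∀ F, ¬ (Φ₁.join Φ₂).IsContractibleEdge F) ∧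
    ¬ (Φ₁.join Φ₂).IsSuspension ∧
    (∀ E, (Φ₁.join Φ₂).IsInducedEquator (n + m + 1) E → (Φ₁.join Φ₂).IsVertexLink E) := by
  have hn₁ := hsphere₁.exists_not_nbr hedge₁
  have hn₂ := hsphere₂.exists_not_nbr hedge₂
  refine ⟨hflag₁.join hflag₂, ?_, ?_, ?_, ?_⟩
  · have h := PreAbstractSimplicialComplex.IsSphereIn.join hsphere₁ hsphere₂
    rwa [show m + 1 + (n + 1) = n + m + 1 + 1 by omega] at h
  · exact PreAbstractSimplicialComplex.not_isContractibleEdge_join hflag₁ hflag₂ hedge₁ hedge₂ hn₁ hn₂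
  · exact fun h => (PreAbstractSimplicialComplex.isSuspension_of_join hflag₁ hflag₂ h).elim hsusp₁ hsusp₂
  · exact fun E hE =>
      PreAbstractSimplicialComplex.isVertexLink_of_isInducedEquator_join hsphere₁ hsphere₂ heq₁ heq₂ hE
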